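/- **Setting.** Let $\Phi$ be the irreducible (reduced, crystallographic) root system, with Weyl group $W$, length function $\ell$, simple roots $\alpha_1,\dots,\alpha_r$, simple reflections $s_i=s_{\alpha_i}$ and weight lattice $\Lambda$, of a simply connected simple complex Lie group $G\supset B\supset T$. Let $\rho$ be the half-sum of the positive roots, $\theta$ the root whose coroot $\theta^\vee$ is the highest coroot, and $h=(\rho,\theta^\vee)+1$. Let $\mathbb Z[X]$ and $\mathbb Z[\tilde X]$ be the group algebras of $\Lambda$ and of $\Lambda/h$, with monomials $x^\mu$. Let $\tilde K=K_T(G/B)\otimes_{\mathbb Z[X]}\mathbb Z[\tilde X]$, the free $\mathbb Z[\tilde X]$-module with basis the Schubert classes $[\mathcal O_w]$, $w\in W$. The $\mathbb Z[\tilde X]$-linear operators $T_i$, $X^\lambda$ ($\lambda\in\Lambda$), $B_\alpha$ and $R_\alpha$ ($\alpha\in\Phi$) on $\tilde K$ are given by - $T_i[\mathcal O_w]=[\mathcal O_{ws_i}]$ if $\ell(ws_i)=\ell(w)+1$, and $T_i[\mathcal O_w]=[\mathcal O_w]$ if $\ell(ws_i)=\ell(w)-1$; - $X^\lambda[\mathcal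 O_w]=x^{w(\lambda/h)}[\mathcal O_w]$; - for $\alpha$ positive, $B_\alpha[\mathcal O_w]=[\mathcal O_{ws_\alpha}]$ if $\ell(ws_\alpha)=\ell(w)-1$, and $B_\alpha[\mathcal O_w]=0$ otherwise; for $\alpha$ negative, $B_\alpha=-B_{-\alpha}$; - $R_\alpha=X^\alpha+X^{(\rho,\alpha^\vee)\alpha}B_\alpha$. Equivalently, $T_i$ is the operator induced by the elementary Demazure operator $f\mapsto (f-e^{-\alpha_i}s_i(f))/(1-e^{-\alpha_i})$ when $K_T(G/B)$ is presented as the quotient of $\mathbb Z[X]\otimes\mathbb Z[\Lambda]$ by the ideal generated by the elements $i(f)\otimes1-1\otimes f$, $f\in\mathbb Z[\Lambda]^W$ (where $i(e^\lambda)=x^\lambda$), the Schubert classes being a $\mathbb Z[X]$-basis with $[\mathcal O_w]=T_{i_l}\cdots T_{i_1}[\mathcal O_1]$ for every reduced decomposition $w=s_{i_1}\cdots s_{i_l}$. Let $s_{\alpha,k}(x)=x-((x,\alpha^\vee)-k)\alpha$ be the affine reflections, which generate $W_{\mathrm{aff}}$. Put $\alpha_0=-\theta$, $s_0=s_{\alpha_0,-1}$,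 and let $\bar s_i=s_{\alpha_i}$ for $0\le i\le r$. Let $A_\circ=\{x: 0<(x,\alpha^\vee)<1 \text{ for all positive roots }\alpha\}$, and let $v_{-\lambda}\in W_{\mathrm{aff}}$ be the element with $v_{-\lambda}(A_\circ)=A_\circ-\lambda$. A $\lambda$-chain is a sequence $(\beta_1,\dots,\beta_l)$ with $\beta_j=\bar s_{i_1}\cdots\bar s_{i_{j-1}}(\alpha_{i_j})$ for some decomposition, reduced or not, $v_{-\lambda}=s_{i_1}\cdots s_{i_l}$, $i_j\in\{0,\dots,r\}$. Put $R^{[\lambda]}=R_{\beta_l}\cdots R_{\beta_1}$ for a $\lambda$-chain $(\beta_1,\dots,\beta_l)$. **Proposition 12.5.** Every weight $\lambda$ has a $\lambda$-chain, the operator $R^{[\lambda]}$ does not depend on the choice of the $\lambda$-chain, and for every $\lambda\in\Lambda$ and $i\in\{1,\dots,r\}$ $$R^{[\lambda]}\,T_i=T_i\,R^{[s_i(\lambda)]}+\sum_{0\le k<(\lambda,\alpha_i^\vee)}R^{[\lambda-k\alpha_i]}-\sum_{(\lambda,\alpha_i^\vee)\le k<0}R^{[\lambda-k\alpha_i]},$$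 the sums being over integers $k$. This holds both for the free module on the Schubert classes with $T_i$ given by the displayed formula and, in the quotient presentation, for the operators induced by the Demazure operators and any $\mathbb Z[X]$-basis $([\mathcal O_w])_{w\in W}$ satisfying $[\mathcal O_w]=T_{i_l}\cdots T_{i_1}[\mathcal O_1]$ for all reduced decompositions as above. -/

import Mathlib

open scoped TensorProduct

noncomputable section

namespace PathOperators

/-! ### Root-system data

Throughout, `P` is an irreducible reduced crystallographic root system in the real vector space `V`
(with dual `N`), `ι` indexes its roots, and `b` is a base, i.e. a system of simple roots.  The
number `(lam, α_i^∨)` is `P.coroot' i lam`. -/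

section RootData

variable {ι V N : Type*} [AddCommGroup V] [Module ℝ V] [AddCommGroup N] [Module ℝ N]

/-- The weight lattice `Λ = {lam | (lam, α^∨) ∈ ℤ for every root α}`. -/
def weightLattice (P : RootPairing ι ℝ V N) : AddSubgroup V where
  carrier := {x | ∀ i, ∃ n : ℤ, (n : ℝ) = P.coroot' i x}
  zero_mem' := fun i => ⟨0, by simp⟩
  add_mem' := by
    intro x y hx hy i
    obtain ⟨m, hm⟩ := hx i
    obtain ⟨n, hn⟩ := hy i
    exact ⟨m + n, by rw [map_add, ← hm, ← hn]; push_cast; ring⟩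
  neg_mem' := by
    intro x hx i
    obtain ⟨m, hm⟩ := hx i
    exact ⟨-m, by rw [map_neg, ← hm]; push_cast; ring⟩

/-- The integer `(lam, α_i^∨)` for a weight `lam`. -/
def weightPairing (P : RootPairing ι ℝ V N) (lam : weightLattice P) (i : ι) : ℤ :=
  (lam.2 i).choose

lemma coe_weightPairing (P : RootPairing ι ℝ V N) (lam : weightLattice P) (i : ι) :
    (weightPairing P lam i : ℝ) = P.coroot' i (lam : V) :=
  (lam.2 i).choose_spec

lemma root_mem_weightLattice (P : RootPairing ι ℝ V N) [P.IsCrystallographic] (i : ι) :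
    P.root i ∈ weightLattice P := by
  intro j
  obtain ⟨n, hn⟩ := P.exists_value (S := ℤ) i j
  exact ⟨n, by simpa using hn⟩

/-- A root, as a weight. -/
def rootWeight (P : RootPairing ι ℝ V N) [P.IsCrystallographic] (i : ι) : weightLattice P :=
  ⟨P.root i, root_mem_weightLattice P i⟩

lemma reflection_mem_weightLattice (P : RootPairing ι ℝ V N) [P.IsCrystallographic] (i : ι)
    {x : V} (hx : x ∈ weightLattice P) : P.reflection i x ∈ weightLattice P := by
  obtain ⟨m, hm⟩ := hx i
  rw [P.reflection_apply, ← hm]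
  have h := (weightLattice P).sub_mem hx
    ((weightLattice P).zsmul_mem (root_mem_weightLattice P i) m)
  rwa [← Int.cast_smul_eq_zsmul ℝ] at h

lemma smul_mem_weightLattice (P : RootPairing ι ℝ V N) [P.IsCrystallographic] (w : P.weylGroup)
    {x : V} (hx : x ∈ weightLattice P) : w • x ∈ weightLattice P := by
  obtain ⟨g, hg⟩ := w
  induction hg using RootPairing.weylGroup.induction generalizing x with
  | mem i => exact reflection_mem_weightLattice P i hx
  | one => simpa [Subgroup.smul_def] using hx
  | mul g₁ g₂ hg₁ hg₂ h₁ h₂ =>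
    have h := h₁ (h₂ hx)
    exact h

/-- The action of the Weyl group on the weight lattice. -/
def weylAct (P : RootPairing ι ℝ V N) [P.IsCrystallographic] (w : P.weylGroup)
    (lam : weightLattice P) : weightLattice P :=
  ⟨w • (lam : V), smul_mem_weightLattice P w lam.2⟩

/-- The reflection `s_α ∈ W` in a root. -/
abbrev rootRefl (P : RootPairing ι ℝ V N) (i : ι) : P.weylGroup := RootPairing.weylGroup.ofIdx P i

/-- The index of the root `-α`. -/
def negRoot (P : RootPairing ι ℝ V N) (i : ι) : ι := P.reflectionPerm i i

/-- The product in `W` of a word in the simple reflections. -/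
def wordProd {P : RootPairing ι ℝ V N} (b : P.Base) (l : List b.support) : P.weylGroup :=
  (l.map fun j => rootRefl P (j : ι)).prod

/-- The length `ℓ(w)`: the least length of a word in the simple reflections with product `w`. -/
def len {P : RootPairing ι ℝ V N} (b : P.Base) (w : P.weylGroup) : ℕ :=
  sInf {n | ∃ l : List b.support, l.length = n ∧ wordProd b l = w}

/-- The height `(ρ, α^∨)` of the coroot `α^∨`, i.e. the sum `c_1 + ⋯ + c_r` of its coefficients in
`α^∨ = c_1 α_1^∨ + ⋯ + c_r α_r^∨`. -/
def coheight {P : RootPairing ι ℝ V N} (b : P.Base) (i : ι) : ℤ := b.flip.height i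

lemma exists_highest (P : RootPairing ι ℝ V N) [Finite ι] [P.IsRootSystem] [P.IsIrreducible]
    (b : P.Base) : ∃ t : ι, ∀ i, coheight b i ≤ coheight b t := by
  have hne : Nonempty ι := by
    by_contra h
    rw [not_nonempty_iff] at h
    have h1 := RootPairing.IsRootSystem.span_root_eq_top (P := P)
    rw [Set.range_eq_empty, Submodule.span_empty] at h1
    have := RootPairing.IsIrreducible.nontrivial (P := P)
    exact bot_ne_top h1
  exact Finite.exists_max _

/-- The root `θ` whose coroot `θ^∨` is the highest coroot. -/
def theta {P : RootPairing ι ℝ V N} [Finite ι] [P.IsRootSystem] [P.IsIrreducible]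
    (b : P.Base) : ι :=
  (exists_highest P b).choose

/-- The Coxeter number `h = (ρ, θ^∨) + 1`. -/
def coxeterNumber {P : RootPairing ι ℝ V N} [Finite ι] [P.IsRootSystem] [P.IsIrreducible]
    (b : P.Base) : ℤ :=
  coheight b (theta b) + 1

lemma coxeterNumber_ne_zero {P : RootPairing ι ℝ V N} [Finite ι] [P.IsRootSystem]
    [P.IsIrreducible] (b : P.Base) : (coxeterNumber b : ℝ) ≠ 0 := by
  have h1 := (exists_highest P b).choose_spec
  have h2 := h1 (negRoot P (theta b))
  have h3 : coheight b (negRoot P (theta b)) = - coheight b (theta b) :=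
    b.flip.height_reflectionPerm_self (theta b)
  have h4 : coheight b (negRoot P (theta b)) ≤ coheight b (theta b) := h2
  have h5 : 0 < coxeterNumber b := by unfold coxeterNumber; lia
  exact_mod_cast h5.ne'

/-! ### The affine Weyl group, alcoves and `lam`-chains -/

/-- The affine reflection `s_{α,k} : x ↦ x - ((x, α^∨) - k) α`. -/
def affineReflection (P : RootPairing ι ℝ V N) (i : ι) (k : ℤ) : Equiv.Perm V :=
  Function.Involutive.toPerm (fun x => x - (P.coroot' i x - (k : ℝ)) • P.root i) (by
    intro x
    have h : P.coroot' i (P.root i) = 2 := P.root_coroot_two i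
    simp only [map_sub, map_smul, h, smul_eq_mul]
    module)

/-- The affine Weyl group `W_aff`, generated by all the affine reflections `s_{α,k}`. -/
def affineWeylGroup (P : RootPairing ι ℝ V N) : Subgroup (Equiv.Perm V) :=
  Subgroup.closure {s | ∃ (i : ι) (k : ℤ), s = affineReflection P i k}

/-- The fundamental alcove `A_∘ = {x | 0 < (x, α^∨) < 1 for every positive root α}`. -/
def fundamentalAlcove {P : RootPairing ι ℝ V N} (b : P.Base) : Set V :=
  {x | ∀ i, b.IsPos i → 0 < P.coroot' i x ∧ P.coroot' i x < 1}

variable {P : RootPairing ι ℝ V N} [Finite ι] [P.IsRootSystem] [P.IsIrreducible]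

/-- The roots `α_0 = -θ, α_1, …, α_r`; the index `0` is `none`. -/
def alpha (b : P.Base) : Option b.support → ι
  | none => negRoot P (theta b)
  | some j => j

/-- The generators of `W_aff`: `s_0 = s_{α_0,-1}` and `s_j = s_{α_j,0}` for `j = 1, …, r`. -/
def affineGen (b : P.Base) : Option b.support → Equiv.Perm V
  | none => affineReflection P (alpha b none) (-1)
  | some j => affineReflection P (alpha b (some j)) 0

/-- `v` is the element `v_{-lam}` of the affine Weyl group, i.e. `v(A_∘) = A_∘ - lam`. -/
def IsTranslatingElement (b : P.Base) (lam : weightLattice P) (v : Equiv.Perm V) : Prop :=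
  v ∈ affineWeylGroup P ∧
    v '' fundamentalAlcove b = (fun x => x - (lam : V)) '' fundamentalAlcove b

/-- The sequence of roots `β_1 = α_{i_1}, β_2 = s̄_{i_1}(α_{i_2}), …,
`β_l = s̄_{i_1} ⋯ s̄_{i_{l-1}}(α_{i_l})` attached to the word `(i_1, …, i_l)`, where `s̄_i` is the
linear part of `s_i`, that is, the reflection in the root `α_i`. -/
def rootSequence (b : P.Base) : List (Option b.support) → List ι
  | [] => []
  | i :: l => alpha b i :: (rootSequence b l).map (P.reflectionPerm (alpha b i))

/-- `(β_1, …, β_l)` is a `lam`-chain (of roots): it is attached to some decomposition, reduced or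
not, `v_{-lam} = s_{i_1} ⋯ s_{i_l}` into generators of the affine Weyl group. -/
def IsLambdaChain (b : P.Base) (lam : weightLattice P) (β : List ι) : Prop :=
  ∃ l : List (Option b.support),
    IsTranslatingElement b lam (l.map (affineGen b)).prod ∧ β = rootSequence b l

end RootData

/-! ### Coefficient rings, Bruhat operators, the `R`-matrix and path operators -/

section Operators

variable {ι V N : Type*} [AddCommGroup V] [Module ℝ V] [AddCommGroup N] [Module ℝ N]
  {P : RootPairing ι ℝ V N}

/-- The character ring `ℤ[X] = R(T)`; the monomial `x^lam` is `AddMonoidAlgebra.single lam 1`. -/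
abbrev CharRing (P : RootPairing ι ℝ V N) : Type _ := AddMonoidAlgebra ℤ (weightLattice P)

variable [Finite ι] [P.IsRootSystem] [P.IsIrreducible]

/-- The lattice `Λ/h = {lam/h | lam ∈ Λ}`, with `h` the Coxeter number. -/
def scaledLattice (b : P.Base) : AddSubgroup V :=
  (weightLattice P).map (DistribSMul.toAddMonoidHom V ((coxeterNumber b : ℝ)⁻¹))

/-- The element `lam/h` of `Λ/h`. -/
def scaleDown (b : P.Base) (lam : weightLattice P) : scaledLattice b :=
  ⟨(coxeterNumber b : ℝ)⁻¹ • (lam : V), ⟨(lam : V), lam.2, rfl⟩⟩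

lemma weightLattice_le_scaledLattice (b : P.Base) : weightLattice P ≤ scaledLattice b := by
  intro x hx
  refine ⟨coxeterNumber b • x, (weightLattice P).zsmul_mem hx _, ?_⟩
  rw [← Int.cast_smul_eq_zsmul ℝ]
  simp [smul_smul, inv_mul_cancel₀ (coxeterNumber_ne_zero b)]

/-- The extended coefficient ring `ℤ[X̃]`, the group algebra of `Λ/h`. -/
abbrev ExtCharRing (b : P.Base) : Type _ := AddMonoidAlgebra ℤ (scaledLattice b)

/-- `ℤ[X̃]` is a `ℤ[X]`-algebra through the inclusion `Λ ⊆ Λ/h`. -/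
instance extAlgebra (b : P.Base) : Algebra (CharRing P) (ExtCharRing b) :=
  (AddMonoidAlgebra.mapDomainRingHom ℤ
    (AddSubgroup.inclusion (weightLattice_le_scaledLattice b))).toAlgebra

/- In the rest of this section `M` is a module over `ℤ[X̃]` and `O` is a basis of it indexed by the
Weyl group; `O w` plays the role of the class `[𝒪_w]`. -/
variable {b : P.Base} {M : Type*} [AddCommGroup M] [Module (ExtCharRing b) M]

/-- The operator `X^lam : [𝒪_w] ↦ x^{w(lam/h)} [𝒪_w]` (note `w(lam/h) = w(lam)/h`). -/
def opX [P.IsCrystallographic] (O : Module.Basis P.weylGroup (ExtCharRing b) M)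
    (lam : weightLattice P) : Module.End (ExtCharRing b) M :=
  O.constr ℤ fun w =>
    (AddMonoidAlgebra.single (scaleDown b (weylAct P w lam)) (1 : ℤ) : ExtCharRing b) • O w

open scoped Classical in
/-- The operator `[𝒪_w] ↦ [𝒪_{w s_α}]` if `ℓ(w s_α) = ℓ(w) - 1`, and `[𝒪_w] ↦ 0` otherwise. -/
def opBPos (O : Module.Basis P.weylGroup (ExtCharRing b) M) (i : ι) :
    Module.End (ExtCharRing b) M :=
  O.constr ℤ fun w => if len b (w * rootRefl P i) + 1 = len b w then O (w * rootRefl P i) else 0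

open scoped Classical in
/-- The Bruhat operator `B_α`: as above for positive roots, and `B_α = -B_{-α}` for negative
ones. -/
def opB (O : Module.Basis P.weylGroup (ExtCharRing b) M) (i : ι) :
    Module.End (ExtCharRing b) M :=
  if b.IsPos i then opBPos O i else - opBPos O (negRoot P i)

/-- The `R`-matrix `R_α = X^α + X^{(ρ, α^∨) α} B_α`. -/
def opR [P.IsCrystallographic] (O : Module.Basis P.weylGroup (ExtCharRing b) M) (i : ι) :
    Module.End (ExtCharRing b) M :=
  opX O (rootWeight P i) + opX O (coheight b i • rootWeight P i) * opB O i

/-- The composition `R_{β_l} R_{β_{l-1}} ⋯ R_{β_1}` for a sequence of roots `(β_1, …, β_l)`. -/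
def chainOperator [P.IsCrystallographic] (O : Module.Basis P.weylGroup (ExtCharRing b) M)
    (β : List ι) : Module.End (ExtCharRing b) M :=
  (β.reverse.map (opR O)).prod

/-- The path operator `R^{[lam]} = R_{β_l} ⋯ R_{β_1}`, where `(β_1, …, β_l)` is some
`lam`-chain. -/
def pathOperator [P.IsCrystallographic] (O : Module.Basis P.weylGroup (ExtCharRing b) M)
    (lam : weightLattice P) : Module.End (ExtCharRing b) M :=
  chainOperator O (Classical.epsilon (IsLambdaChain b lam))

/-! ### `K̃_T(G/B)` as the free module on the Schubert classes -/

/-- The free `ℤ[X̃]`-module with basis the Schubert classes `[𝒪_w]`, `w ∈ W`. -/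
abbrev SchubertModule (b : P.Base) : Type _ := P.weylGroup →₀ ExtCharRing b

/-- The basis `[𝒪_w]` of the free module. -/
def schubertClass (b : P.Base) :
    Module.Basis P.weylGroup (ExtCharRing b) (SchubertModule b) :=
  Finsupp.basisSingleOne

open scoped Classical in
/-- The operator `T_i` on the Schubert classes: `[𝒪_w] ↦ [𝒪_{w s_i}]` if `ℓ(w s_i) = ℓ(w) + 1`,
and `[𝒪_w] ↦ [𝒪_w]` otherwise, i.e. if `ℓ(w s_i) = ℓ(w) - 1`. -/
def schubertT (b : P.Base) (i : b.support) : Module.End (ExtCharRing b) (SchubertModule b) :=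
  (schubertClass b).constr ℤ fun w =>
    if len b (w * rootRefl P (i : ι)) = len b w + 1 then schubertClass b (w * rootRefl P (i : ι))
    else schubertClass b w

end Operators

/-! ### `K_T(G/B)` as a quotient of `ℤ[X] ⊗ ℤ[Λ]`, with its Demazure operators -/

section Presentation

variable {ι V N : Type*} [AddCommGroup V] [Module ℝ V] [AddCommGroup N] [Module ℝ N]

/-- The ring `ℤ[X] ⊗ ℤ[Λ]`, as the group algebra of `Λ` over `ℤ[X]`; the monomial `e^lam` is
`AddMonoidAlgebra.single lam 1`. -/
abbrev BigRing (P : RootPairing ι ℝ V N) : Type _ :=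
  AddMonoidAlgebra (CharRing P) (weightLattice P)

/-- The monomial `e^lam`. -/
def expo (P : RootPairing ι ℝ V N) (lam : weightLattice P) : BigRing P :=
  AddMonoidAlgebra.single lam 1

lemma expo_mul (P : RootPairing ι ℝ V N) (x y : weightLattice P) : expo P x * expo P y = expo P (x + y) := by
  simp [expo, AddMonoidAlgebra.single_mul_single]

variable (P : RootPairing ι ℝ V N) [P.IsCrystallographic]

/-- The Weyl group element `w` acts additively on weights. -/
def weylActHom (w : P.weylGroup) : weightLattice P →+ weightLattice P where
  toFun := weylAct P w
  map_zero' := Subtype.ext (smul_zero _)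
  map_add' := fun _ _ => Subtype.ext (smul_add _ _ _)

/-- The action of `w` on `ℤ[Λ]`, `e^lam ↦ e^{w(lam)}`. -/
def weylSmall (w : P.weylGroup) :
    AddMonoidAlgebra ℤ (weightLattice P) →+* AddMonoidAlgebra ℤ (weightLattice P) :=
  AddMonoidAlgebra.mapDomainRingHom ℤ (weylActHom P w)

/-- The `ℤ[X]`-linear action of `w` on `ℤ[X] ⊗ ℤ[Λ]`. -/
def weylBig (w : P.weylGroup) : BigRing P →+* BigRing P :=
  AddMonoidAlgebra.mapDomainRingHom (CharRing P) (weylActHom P w)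

/-- The inclusion `f ↦ 1 ⊗ f` of `ℤ[Λ]` into `ℤ[X] ⊗ ℤ[Λ]`. -/
def rightIncl : AddMonoidAlgebra ℤ (weightLattice P) →+* BigRing P :=
  AddMonoidAlgebra.mapRingHom (weightLattice P) (Int.castRingHom (CharRing P))

/-- The ideal `ℐ` generated by `i(f) ⊗ 1 - 1 ⊗ f` for `W`-invariant `f ∈ ℤ[Λ]`, where `i` is the
isomorphism `e^lam ↦ x^lam` (the identity, as both rings are the group algebra of `Λ`). -/
def invIdeal : Ideal (BigRing P) :=
  Ideal.span {a | ∃ f : AddMonoidAlgebra ℤ (weightLattice P),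
    (∀ w : P.weylGroup, weylSmall P w f = f) ∧
      a = algebraMap (CharRing P) (BigRing P) f - rightIncl P f}

/-- The Grothendieck ring `K_T(G/B) = (ℤ[X] ⊗ ℤ[Λ]) / ℐ`. -/
abbrev KT : Type _ := BigRing P ⧸ invIdeal P

/-- The elementary Demazure operator on `ℤ[X] ⊗ ℤ[Λ]` attached to a root `α`: the `ℤ[X]`-linear map
`f ↦ (f - e^{-α} s_α(f)) / (1 - e^{-α})`, here through the expansion of the quotient for
`f = e^lam`; see `demazure_spec` and `demazure_unique`. -/
def demazure (i : ι) : BigRing P →ₗ[CharRing P] BigRing P :=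
  (AddMonoidAlgebra.basis (weightLattice P) (CharRing P)).constr ℤ fun lam =>
    (∑ k ∈ Finset.Ico 0 (weightPairing P lam i + 1), expo P (lam - k • rootWeight P i)) -
      ∑ k ∈ Finset.Ico (weightPairing P lam i + 1) 0, expo P (lam - k • rootWeight P i)

lemma int_telescope {A : Type*} [AddCommGroup A] (g : ℤ → A) (m : ℤ) :
    (∑ k ∈ Finset.Ico 0 m, (g k - g (k + 1))) - ∑ k ∈ Finset.Ico m 0, (g k - g (k + 1))
      = g 0 - g m := by
  induction m using Int.induction_on with
  | zero => simp
  | succ i ih =>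
    have h1 : Finset.Ico (0 : ℤ) (i + 1) = insert (i : ℤ) (Finset.Ico 0 (i : ℤ)) := by
      ext x; simp only [Finset.mem_Ico, Finset.mem_insert]; lia
    have h2 : Finset.Ico ((i : ℤ) + 1) 0 = ∅ := Finset.Ico_eq_empty (by lia)
    have h3 : Finset.Ico (i : ℤ) 0 = ∅ := Finset.Ico_eq_empty (by lia)
    rw [h3, Finset.sum_empty, sub_zero] at ih
    rw [h1, h2, Finset.sum_insert (by simp), ih, Finset.sum_empty]
    abel
  | pred i ih =>
    have h1 : Finset.Ico (-(i : ℤ) - 1) 0 = insert (-(i : ℤ) - 1) (Finset.Ico (-(i : ℤ)) 0) := by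
      ext x; simp only [Finset.mem_Ico, Finset.mem_insert]; lia
    have h2 : Finset.Ico 0 (-(i : ℤ) - 1) = ∅ := Finset.Ico_eq_empty (by lia)
    have h3 : Finset.Ico 0 (-(i : ℤ)) = ∅ := Finset.Ico_eq_empty (by lia)
    rw [h3, Finset.sum_empty, zero_sub] at ih
    rw [h1, h2, Finset.sum_insert (by simp), Finset.sum_empty, zero_sub, neg_add, ih,
      sub_add_cancel]
    abel

lemma weylBig_expo (w : P.weylGroup) (x : weightLattice P) :
    weylBig P w (expo P x) = expo P (weylAct P w x) := by
  simp [weylBig, expo, weylActHom]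

lemma weylBig_smul (w : P.weylGroup) (c : CharRing P) (f : BigRing P) :
    weylBig P w (c • f) = c • weylBig P w f := by
  simp [weylBig]

lemma weylAct_refl (i : ι) (lam : weightLattice P) :
    weylAct P (rootRefl P i) lam = lam - weightPairing P lam i • rootWeight P i := by
  apply Subtype.ext
  change P.reflection i (lam : V) = (lam : V) - weightPairing P lam i • P.root i
  rw [P.reflection_apply, ← coe_weightPairing, Int.cast_smul_eq_zsmul]

/-- The Demazure operator is given by the quotient `(f - e^{-α} s_α(f)) / (1 - e^{-α})`. -/
lemma demazure_spec (i : ι) (f : BigRing P) :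
    (1 - expo P (-rootWeight P i)) * demazure P i f =
      f - expo P (-rootWeight P i) * weylBig P (rootRefl P i) f := by
  let L : BigRing P →ₗ[CharRing P] BigRing P :=
    LinearMap.mulLeft (CharRing P) (1 - expo P (-rootWeight P i)) ∘ₗ demazure P i
  let s : BigRing P →ₗ[CharRing P] BigRing P :=
    { toFun := weylBig P (rootRefl P i)
      map_add' := map_add _
      map_smul' := weylBig_smul P _ }
  let R : BigRing P →ₗ[CharRing P] BigRing P :=
    LinearMap.id - LinearMap.mulLeft (CharRing P) (expo P (-rootWeight P i)) ∘ₗ s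
  have h : L = R := by
    apply (AddMonoidAlgebra.basis (weightLattice P) (CharRing P)).ext
    intro lam
    have hd : demazure P i (AddMonoidAlgebra.basis (weightLattice P) (CharRing P) lam) =
        (∑ k ∈ Finset.Ico 0 (weightPairing P lam i + 1), expo P (lam - k • rootWeight P i)) -
        ∑ k ∈ Finset.Ico (weightPairing P lam i + 1) 0, expo P (lam - k • rootWeight P i) :=
      Module.Basis.constr_basis _ _ _ _
    have he : AddMonoidAlgebra.basis (weightLattice P) (CharRing P) lam = expo P lam := rfl
    change (1 - expo P (-rootWeight P i)) * demazure P i _ =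
      _ - expo P (-rootWeight P i) * weylBig P (rootRefl P i) _
    rw [hd, he, weylBig_expo, weylAct_refl, expo_mul, mul_sub, Finset.mul_sum, Finset.mul_sum]
    have hk : ∀ k : ℤ, (1 - expo P (-rootWeight P i)) * expo P (lam - k • rootWeight P i) =
        expo P (lam - k • rootWeight P i) - expo P (lam - (k + 1) • rootWeight P i) := by
      intro k
      rw [sub_mul, one_mul, expo_mul]
      congr 2
      module
    simp only [hk]
    rw [int_telescope (fun k : ℤ => expo P (lam - k • rootWeight P i))]
    congr 2
    · simp
    · module
  exact LinearMap.congr_fun h f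

instance : UniqueSums (weightLattice P) := by
  have : Module ℚ V := Module.compHom V (algebraMap ℚ ℝ)
  exact UniqueSums.of_injective_addHom (weightLattice P).subtype.toAddHom
    (Subtype.coe_injective) inferInstance

lemma one_sub_expo_ne_zero (i : ι) : (1 - expo P (-rootWeight P i)) ≠ 0 := by
  intro h
  have h1 : expo P (-rootWeight P i) = expo P 0 := (sub_eq_zero.mp h).symm
  have h2 := Finsupp.single_left_injective (one_ne_zero)
    (congrArg AddMonoidAlgebra.coeff h1)
  have h3 : (rootWeight P i : V) = 0 := by simpa using congrArg Subtype.val h2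
  exact P.ne_zero i h3

lemma demazure_unique (i : ι) (f g : BigRing P)
    (h : (1 - expo P (-rootWeight P i)) * g =
      f - expo P (-rootWeight P i) * weylBig P (rootRefl P i) f) : g = demazure P i f :=
  mul_left_cancel₀ (one_sub_expo_ne_zero P i) (h.trans (demazure_spec P i f).symm)

lemma demazure_mul (i : ι) (f g : BigRing P) (hf : weylBig P (rootRefl P i) f = f) :
    demazure P i (f * g) = f * demazure P i g := by
  symm
  apply demazure_unique
  rw [mul_left_comm, demazure_spec, map_mul, hf]
  ring

lemma weylBig_rightIncl (w : P.weylGroup) (f : AddMonoidAlgebra ℤ (weightLattice P)) :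
    weylBig P w (rightIncl P f) = rightIncl P (weylSmall P w f) := by
  have h : (weylBig P w).comp (rightIncl P) = (rightIncl P).comp (weylSmall P w) := by
    ext x <;> simp [weylBig, rightIncl, weylSmall]
  exact congrArg (fun φ => φ f) h

lemma weylBig_algebraMap (w : P.weylGroup) (c : CharRing P) :
    weylBig P w (algebraMap (CharRing P) (BigRing P) c) = algebraMap _ _ c := by
  rw [Algebra.algebraMap_eq_smul_one, weylBig_smul, map_one]

/-- The Demazure operators preserve the ideal `ℐ`. -/
lemma demazure_mem (i : ι) (f : BigRing P) (hf : f ∈ invIdeal P) :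
    demazure P i f ∈ invIdeal P := by
  suffices h : ∀ g : BigRing P, demazure P i (g * f) ∈ invIdeal P by simpa using h 1
  induction hf using Submodule.span_induction with
  | mem a ha =>
    intro g
    obtain ⟨f, hf, rfl⟩ := ha
    rw [mul_comm, demazure_mul P i _ g
      (by rw [map_sub, weylBig_algebraMap, weylBig_rightIncl, hf])]
    exact Ideal.mul_mem_right _ _ (Ideal.subset_span ⟨f, hf, rfl⟩)
  | zero => simp
  | add x y _ _ hx hy =>
    intro g
    rw [mul_add, map_add]
    exact add_mem (hx g) (hy g)
  | smul a x _ hx =>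
    intro g
    rw [smul_eq_mul, ← mul_assoc]
    exact hx _

/-- The operator on `K_T(G/B)` induced by the Demazure operator: `[f] ↦ [T(f)]`. -/
def demazureKT (i : ι) : Module.End (CharRing P) (KT P) where
  toFun := Quotient.map' (demazure P i) (by
    intro f g h
    rw [Submodule.quotientRel_def] at h ⊢
    rw [← map_sub]
    exact demazure_mem P i _ h)
  map_add' := by
    rintro ⟨f⟩ ⟨g⟩
    exact congrArg (Ideal.Quotient.mk (invIdeal P)) (map_add (demazure P i) f g)
  map_smul' := by
    rintro c ⟨f⟩
    exact congrArg (Ideal.Quotient.mk (invIdeal P)) (map_smul (demazure P i) c f)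

lemma demazureKT_mk (i : ι) (f : BigRing P) :
    demazureKT P i (Ideal.Quotient.mk (invIdeal P) f) =
      Ideal.Quotient.mk (invIdeal P) (demazure P i f) := rfl

variable {P} [Finite ι] [P.IsRootSystem] [P.IsIrreducible]

/-- The extension of scalars `K̃_T(G/B) = ℤ[X̃] ⊗ K_T(G/B)` over `ℤ[X]`. -/
abbrev KTExt (b : P.Base) : Type _ := ExtCharRing b ⊗[CharRing P] KT P

/-- The operator `T_i` on `K̃_T(G/B)` induced by the elementary Demazure operator. -/
def demazureExt (b : P.Base) (i : b.support) : Module.End (ExtCharRing b) (KTExt b) :=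
  (demazureKT P (i : ι)).baseChange (ExtCharRing b)

/-- A `ℤ[X]`-basis `([𝒪_w])` of `K_T(G/B)` such that `[𝒪_w] = T_{w⁻¹}([𝒪_1])` for all `w`, that is,
`[𝒪_w] = T_{i_l} ⋯ T_{i_1}([𝒪_1])` for every reduced decomposition `w = s_{i_1} ⋯ s_{i_l}`. -/
def IsSchubertBasis (b : P.Base) (O : Module.Basis P.weylGroup (CharRing P) (KT P)) : Prop :=
  ∀ l : List b.support, l.length = len b (wordProd b l) →
    O (wordProd b l) = (l.reverse.map fun i => demazureKT P (i : ι)).prod (O 1)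

/-- The basis of `K̃_T(G/B)` over `ℤ[X̃]` obtained from a basis of `K_T(G/B)` over `ℤ[X]`. -/
def extBasis (b : P.Base) (O : Module.Basis P.weylGroup (CharRing P) (KT P)) :
    Module.Basis P.weylGroup (ExtCharRing b) (KTExt b) :=
  O.baseChange (ExtCharRing b)

end Presentation

end PathOperators

end

open PathOperators

open scoped TensorProduct

noncomputable section

namespace PathOperators

/-! ### The Weyl group action on roots and weights -/

section WeylAction

variable {ι V N : Type*} [AddCommGroup V] [Module ℝ V] [AddCommGroup N] [Module ℝ N]
  (P : RootPairing ι ℝ V N)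

/-! Each alcove is recorded by its central point, a point `w(ρ/h) + μ` with `μ ∈ Λ`. Such a point
lies on no wall, `ρ/h` is the only one in the fundamental alcove, and membership of `v ∈ W_aff` in
the class of `v_{-λ}` is decided by `v(ρ/h) = ρ/h - λ`. A `λ`-chain thus becomes the list of roots
crossed along a path of adjacent central points from `ρ/h + λ` to `ρ/h`, where crossing `β`
subtracts `β/h` (`IsLambdaChain.isPath`).

The heart of the proof is a family of classes `F_w(q)` (`alcoveClass`), for `w ∈ W` and `q` a
central point, such that `F_w(ρ/h) = [O_w]` and such that crossing the wall `(x, β^∨) = k` with `β`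
positive subtracts `x^{-k w(β)} F_{w s_β}(q)` if `ℓ(w s_β) = ℓ(w) - 1` and changes nothing
otherwise. Up to a monomial this is the effect of `R_β`. Hence the product of the `R_β` along any
path from `q` sends `[O_w]` to `x^{w(q - ρ/h)} F_w(q)` (`chainOperator_apply`). The right side does
not mention the path, which gives independence of the chain.

The classes are built by induction on length from the recursion (`lift`) `F_{u s_j}(p) = T_j F_u(s_j
p) + ∑_{0 < i ≤ ⌊(p, α_j^∨)⌋} x^{i u(α_j)} F_u(s_j p + i α_j)` for `u(α_j)` positive, the sum being
signed when the floor is negative. The crossing rule survives the recursion (`crossingRule_lift`);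
terms that should not occur vanish because lifting twice along the same `j` gives zero
(`lift_lift`). The rule and the value at `ρ/h` determine a function on central points
(`eq_of_cross`), so the choice of the descent `j` is immaterial (`hasCrossingRule`).

Read at `p = ρ/h + λ`, the recursion is the commutation relation applied to `[O_u]` with `u(α_j)`
positive. The other basis vectors are of the form `T_j [O_z]`, and for them the relation follows
from `T_j² = T_j`. Only the values of `T_j` on the basis enter (`ActsAsDemazure`), so the free
module and the quotient presentation are handled together. -/

lemma root_smul (w : P.weylGroup) (i : ι) : P.root (w • i) = w • P.root i :=
  (P.weylGroup_apply_root w i).symm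

lemma rootRefl_smul (i : ι) (x : V) :
    rootRefl P i • x = x - P.coroot' i x • P.root i := rfl

lemma rootRefl_smul_index (i j : ι) : rootRefl P i • j = P.reflectionPerm i j := by
  apply P.root.injective
  rw [root_smul, P.root_reflectionPerm]
  rfl

lemma weyl_ext {w w' : P.weylGroup} (h : ∀ x : V, w • x = w' • x) : w = w' := by
  apply Subtype.ext
  apply RootPairing.Equiv.weightHom_injective P
  ext x
  exact h x

lemma coroot'_smul_smul (w : P.weylGroup) (i : ι) (x : V) :
    P.coroot' (w • i) (w • x) = P.coroot' i x := by
  obtain ⟨g, hg⟩ := w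
  induction hg using RootPairing.weylGroup.induction generalizing i x with
  | mem j =>
    have h : P.coroot' (rootRefl P j • i) (rootRefl P j • x) = P.coroot' i x := by
      rw [rootRefl_smul_index, RootPairing.coroot'_reflectionPerm]
      exact congrArg (P.coroot' i) (P.reflection_same j x)
    exact h
  | one =>
    change P.coroot' ((1 : P.weylGroup) • i) ((1 : P.weylGroup) • x) = _
    rw [one_smul, one_smul]
  | mul g₁ g₂ hg₁ hg₂ h₁ h₂ =>
    change P.coroot' (((⟨g₁, hg₁⟩ : P.weylGroup) * ⟨g₂, hg₂⟩) • i)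
      (((⟨g₁, hg₁⟩ : P.weylGroup) * ⟨g₂, hg₂⟩) • x) = _
    rw [mul_smul, mul_smul, h₁, h₂]

lemma coroot'_smul (w : P.weylGroup) (i : ι) (x : V) :
    P.coroot' i (w • x) = P.coroot' (w⁻¹ • i) x := by
  rw [← coroot'_smul_smul P w (w⁻¹ • i) x, smul_inv_smul]

lemma weyl_smul_smul (w : P.weylGroup) (t : ℝ) (x : V) : w • (t • x) = t • (w • x) :=
  smul_comm w t x

lemma weyl_smul_add (w : P.weylGroup) (x y : V) : w • (x + y) = w • x + w • y :=
  smul_add w x y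

lemma weyl_smul_sub (w : P.weylGroup) (x y : V) : w • (x - y) = w • x - w • y :=
  smul_sub w x y

lemma rootRefl_mul_self (i : ι) : rootRefl P i * rootRefl P i = 1 := by
  apply weyl_ext
  intro x
  rw [mul_smul, one_smul]
  exact P.reflection_same i x

lemma rootRefl_inv (i : ι) : (rootRefl P i)⁻¹ = rootRefl P i :=
  inv_eq_of_mul_eq_one_left (rootRefl_mul_self P i)

lemma mul_rootRefl_mul_rootRefl (w : P.weylGroup) (i : ι) :
    w * rootRefl P i * rootRefl P i = w := by
  rw [mul_assoc, rootRefl_mul_self, mul_one]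

lemma mul_rootRefl (w : P.weylGroup) (i : ι) :
    w * rootRefl P i = rootRefl P (w • i) * w := by
  apply weyl_ext
  intro x
  rw [mul_smul, mul_smul, rootRefl_smul, rootRefl_smul, coroot'_smul_smul, root_smul,
    weyl_smul_sub, weyl_smul_smul]

lemma root_negRoot (i : ι) : P.root (negRoot P i) = - P.root i := by
  simp [negRoot]

lemma coroot'_negRoot (i : ι) (x : V) : P.coroot' (negRoot P i) x = - P.coroot' i x := by
  rw [negRoot, RootPairing.coroot'_reflectionPerm, LinearMap.comp_apply]
  have h := P.root_coroot_two i
  simp only [LinearEquiv.coe_coe, RootPairing.reflection_apply, map_sub, map_smul]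
  have h2 : P.coroot' i (P.root i) = 2 := h
  rw [h2, smul_eq_mul]
  ring

lemma negRoot_negRoot (i : ι) : negRoot P (negRoot P i) = i := by
  apply P.root.injective
  rw [root_negRoot, root_negRoot, neg_neg]

lemma smul_negRoot (w : P.weylGroup) (i : ι) : w • negRoot P i = negRoot P (w • i) := by
  apply P.root.injective
  rw [root_smul, root_negRoot, root_negRoot, root_smul, smul_neg]

lemma rootRefl_negRoot (i : ι) : rootRefl P (negRoot P i) = rootRefl P i := by
  apply weyl_ext
  intro x
  rw [rootRefl_smul, rootRefl_smul, coroot'_negRoot, root_negRoot, neg_smul_neg]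

lemma rootRefl_smul_self (i : ι) : rootRefl P i • i = negRoot P i :=
  rootRefl_smul_index P i i

lemma coroot'_root_self (i : ι) : P.coroot' i (P.root i) = 2 := P.root_coroot_two i

end WeylAction

/-! ### Positive roots and lengths -/

section Length

variable {ι V N : Type*} [AddCommGroup V] [Module ℝ V] [AddCommGroup N] [Module ℝ N]
  {P : RootPairing ι ℝ V N} (b : P.Base)

lemma isPos_negRoot (i : ι) : b.IsPos (negRoot P i) ↔ ¬ b.IsPos i :=
  RootPairing.Base.IsPos.neg_iff_not b i

lemma wordProd_nil : wordProd b [] = 1 := rfl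

lemma wordProd_cons (i : b.support) (l : List b.support) :
    wordProd b (i :: l) = rootRefl P (i : ι) * wordProd b l := by
  simp [wordProd]

lemma wordProd_append (l l' : List b.support) :
    wordProd b (l ++ l') = wordProd b l * wordProd b l' := by
  simp [wordProd]

lemma len_wordProd_le (l : List b.support) : len b (wordProd b l) ≤ l.length :=
  Nat.sInf_le ⟨l, rfl, rfl⟩

lemma len_one : len b (1 : P.weylGroup) = 0 :=
  Nat.le_zero.mp (len_wordProd_le b [])

variable [Finite ι] [P.IsCrystallographic] [P.IsReduced]

lemma isPos_rootRefl_smul {i : ι} (j : b.support) (hi : b.IsPos i) (hij : i ≠ j) :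
    b.IsPos (rootRefl P (j : ι) • i) := by
  rw [rootRefl_smul_index]
  exact hi.reflectionPerm j.2 hij

lemma isPos_rootRefl_smul_iff {i : ι} (j : b.support) (h1 : i ≠ j) (h2 : i ≠ negRoot P j) :
    b.IsPos (rootRefl P (j : ι) • i) ↔ b.IsPos i := by
  constructor
  · intro h
    by_contra hn
    rw [← isPos_negRoot] at hn
    have h3 := isPos_rootRefl_smul b j hn (fun h' => h2 (by rw [← h', negRoot_negRoot]))
    rw [smul_negRoot, isPos_negRoot] at h3
    exact h3 h
  · exact fun h => isPos_rootRefl_smul b j h h1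

/-- Letting the letters act on the root from the right, the sign changes at some letter `s_j`, and
there the root has become `α_j`. Deleting that letter amounts to multiplying by `s_i` on the right.
-/
lemma exchange (l : List b.support) (i : ι) (hi : b.IsPos i)
    (hl : ¬ b.IsPos (wordProd b l • i)) :
    ∃ l' : List b.support, l'.length < l.length ∧
      wordProd b l' = wordProd b l * rootRefl P i := by
  induction l with
  | nil =>
    rw [wordProd_nil, one_smul] at hl
    exact absurd hi hl
  | cons j l ih =>
    by_cases h : b.IsPos (wordProd b l • i)
    · have h1 : wordProd b l • i = j := by
        by_contra h2
        apply hl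
        rw [wordProd_cons, mul_smul]
        exact isPos_rootRefl_smul b j h h2
      refine ⟨l, by simp, ?_⟩
      rw [wordProd_cons, mul_assoc, mul_rootRefl, h1, ← mul_assoc, rootRefl_mul_self, one_mul]
    · obtain ⟨l', h1, h2⟩ := ih h
      exact ⟨j :: l', by simpa using h1, by rw [wordProd_cons, wordProd_cons, h2, mul_assoc]⟩

lemma exists_word_rootRefl (i : ι) : ∃ l : List b.support, wordProd b l = rootRefl P i := by
  induction i using b.induction_reflect with
  | h₀ i h =>
    obtain ⟨l, hl⟩ := h
    exact ⟨l, by rw [hl]; exact (rootRefl_negRoot P i).symm⟩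
  | h₁ i hi => exact ⟨[⟨i, hi⟩], by simp [wordProd]⟩
  | h₂ i j h hj =>
    obtain ⟨l, hl⟩ := h
    refine ⟨⟨j, hj⟩ :: (l ++ [⟨j, hj⟩]), ?_⟩
    have h := mul_rootRefl P (rootRefl P j) i
    rw [wordProd_cons, wordProd_append, hl, wordProd_cons, wordProd_nil, mul_one,
      ← rootRefl_smul_index, ← mul_assoc, h, mul_rootRefl_mul_rootRefl]

lemma exists_word (w : P.weylGroup) : ∃ l : List b.support, wordProd b l = w := by
  obtain ⟨g, hg⟩ := w
  induction hg using RootPairing.weylGroup.induction with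
  | mem i => exact exists_word_rootRefl b i
  | one => exact ⟨[], rfl⟩
  | mul g₁ g₂ hg₁ hg₂ h₁ h₂ =>
    obtain ⟨l₁, h₁⟩ := h₁
    obtain ⟨l₂, h₂⟩ := h₂
    exact ⟨l₁ ++ l₂, by rw [wordProd_append, h₁, h₂]; rfl⟩

lemma exists_reduced (w : P.weylGroup) :
    ∃ l : List b.support, l.length = len b w ∧ wordProd b l = w := by
  obtain ⟨l, hl⟩ := exists_word b w
  exact Nat.sInf_mem (s := {n | ∃ l : List b.support, l.length = n ∧ wordProd b l = w})
    ⟨l.length, l, rfl, hl⟩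

lemma len_mul_rootRefl_lt {w : P.weylGroup} {i : ι} (hi : b.IsPos i)
    (hw : ¬ b.IsPos (w • i)) : len b (w * rootRefl P i) < len b w := by
  obtain ⟨l, h1, rfl⟩ := exists_reduced b w
  obtain ⟨l', h2, h3⟩ := exchange b l i hi hw
  rw [← h3, ← h1]
  exact (len_wordProd_le b l').trans_lt h2

lemma len_lt_mul_rootRefl {w : P.weylGroup} {i : ι} (hi : b.IsPos i)
    (hw : b.IsPos (w • i)) : len b w < len b (w * rootRefl P i) := by
  have h := len_mul_rootRefl_lt b (w := w * rootRefl P i) hi (by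
    rw [mul_smul, rootRefl_smul_self, smul_negRoot, isPos_negRoot, not_not]
    exact hw)
  rwa [mul_rootRefl_mul_rootRefl] at h

lemma len_mul_simple_le (w : P.weylGroup) (j : b.support) :
    len b (w * rootRefl P (j : ι)) ≤ len b w + 1 := by
  obtain ⟨l, h1, rfl⟩ := exists_reduced b w
  have h := len_wordProd_le b (l ++ [j])
  rw [wordProd_append, wordProd_cons, wordProd_nil, mul_one] at h
  simpa [← h1] using h

lemma len_mul_simple_of_isPos {w : P.weylGroup} {j : b.support} (h : b.IsPos (w • (j : ι))) :
    len b (w * rootRefl P (j : ι)) = len b w + 1 := by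
  have h1 := len_lt_mul_rootRefl b (b.isPos_of_mem_support j.2) h
  have h2 := len_mul_simple_le b w j
  lia

lemma len_mul_simple_of_not_isPos {w : P.weylGroup} {j : b.support}
    (h : ¬ b.IsPos (w • (j : ι))) : len b (w * rootRefl P (j : ι)) + 1 = len b w := by
  have h1 := len_mul_rootRefl_lt b (b.isPos_of_mem_support j.2) h
  have h2 := len_mul_simple_le b (w * rootRefl P (j : ι)) j
  rw [mul_rootRefl_mul_rootRefl] at h2
  lia

lemma len_mul_simple_eq_iff (w : P.weylGroup) (j : b.support) :
    len b (w * rootRefl P (j : ι)) = len b w + 1 ↔ b.IsPos (w • (j : ι)) := by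
  constructor
  · intro h
    by_contra hn
    have := len_mul_simple_of_not_isPos b hn
    lia
  · exact len_mul_simple_of_isPos b

lemma exists_descent {w : P.weylGroup} (hw : w ≠ 1) :
    ∃ j : b.support, ¬ b.IsPos (w • (j : ι)) := by
  obtain ⟨l, h1, rfl⟩ := exists_reduced b w
  rcases List.eq_nil_or_concat l with rfl | ⟨l, j, rfl⟩
  · exact absurd (wordProd_nil b) hw
  · refine ⟨j, fun h => ?_⟩
    have h2 := len_mul_simple_of_isPos b h
    rw [List.concat_eq_append] at h1 h2
    rw [wordProd_append, wordProd_cons, wordProd_nil, mul_one, mul_rootRefl_mul_rootRefl] at h2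
    have h3 := len_wordProd_le b l
    rw [wordProd_append, wordProd_cons, wordProd_nil, mul_one, List.length_append] at h1
    simp at h1
    lia

end Length

/-! ### Heights of coroots and the highest coroot -/

section Heights

variable {ι V N : Type*} [AddCommGroup V] [Module ℝ V] [AddCommGroup N] [Module ℝ N]
  {P : RootPairing ι ℝ V N}

lemma coroot'_root (P : RootPairing ι ℝ V N) [P.IsCrystallographic] (i j : ι) :
    P.coroot' i (P.root j) = (P.pairingIn ℤ j i : ℝ) := by
  rw [RootPairing.root_coroot'_eq_pairing]
  exact (P.algebraMap_pairingIn ℤ j i).symm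

lemma coroot'_rootRefl_index (P : RootPairing ι ℝ V N) (i j : ι) (x : V) :
    P.coroot' (rootRefl P i • j) x = P.coroot' j x - P.coroot' i x * P.coroot' j (P.root i) := by
  rw [rootRefl_smul_index, RootPairing.coroot'_reflectionPerm, LinearMap.comp_apply,
    LinearEquiv.coe_coe, RootPairing.reflection_apply, map_sub, map_smul, smul_eq_mul]

variable (b : P.Base)

/-- A simple reflection `s_j` changes the sign of a root only when the root is `± α_j`, and the same
holds for coroots. The two notions of positivity therefore propagate in the same way from the simple
roots. -/
lemma isPos_flip_iff [Finite ι] [P.IsCrystallographic] [P.IsReduced] (i : ι) :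
    b.flip.IsPos i ↔ b.IsPos i := by
  have hneg : ∀ i, (b.flip.IsPos (P.reflectionPerm i i) ↔ ¬ b.flip.IsPos i) :=
    isPos_negRoot b.flip
  have hneg' : ∀ i, (b.IsPos (P.reflectionPerm i i) ↔ ¬ b.IsPos i) := isPos_negRoot b
  induction i using b.induction_reflect with
  | h₀ i h => exact (hneg i).trans ((not_congr h).trans (hneg' i).symm)
  | h₁ i hi =>
    exact iff_of_true (b.flip.isPos_of_mem_support hi) (b.isPos_of_mem_support hi)
  | h₂ i j h hj =>
    rcases eq_or_ne i j with rfl | h1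
    · exact (hneg i).trans ((not_congr h).trans (hneg' i).symm)
    rcases eq_or_ne i (negRoot P j) with rfl | h2
    · have h3 : P.reflectionPerm j (negRoot P j) = j := P.reflectionPerm_self j j
      rw [h3]
      exact iff_of_true (b.flip.isPos_of_mem_support hj) (b.isPos_of_mem_support hj)
    · have h3 := isPos_rootRefl_smul_iff b ⟨j, hj⟩ h1 h2
      have h4 := isPos_rootRefl_smul_iff b.flip ⟨j, hj⟩ h1 h2
      rw [rootRefl_smul_index] at h3 h4
      exact h4.trans (h.trans h3.symm)

lemma coheight_pos_iff [Finite ι] [P.IsCrystallographic] [P.IsReduced] (i : ι) :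
    0 < coheight b i ↔ b.IsPos i := isPos_flip_iff b i

lemma exists_coroot'_eq_sum [Finite ι] [P.IsCrystallographic] [P.IsReduced] {i : ι}
    (hi : b.IsPos i) :
    ∃ f : b.support → ℤ, (∀ j, 0 ≤ f j) ∧
      ∀ x, P.coroot' i x = ∑ j, (f j : ℝ) * P.coroot' (j : ι) x := by
  obtain ⟨f, hf₀, hf₁, hf₂⟩ := b.flip.exists_root_eq_sum_int i
  have hpos : 0 < f := by
    refine hf₁.resolve_right fun hneg => ?_
    have h := (isPos_flip_iff b i).mpr hi
    rw [RootPairing.Base.isPos_iff, RootPairing.Base.height_eq_sum hf₂] at h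
    exact absurd h (not_lt.mpr (Finset.sum_nonpos fun i _ => hneg.le i))
  refine ⟨fun j => f j, fun j => hpos.le j, fun x => ?_⟩
  have h : P.coroot i = ∑ j ∈ b.support, f j • P.coroot j := hf₂
  change P.toLinearMap x (P.coroot i) = ∑ j : b.support, (f j : ℝ) * P.toLinearMap x (P.coroot j)
  rw [h, map_sum, ← Finset.sum_coe_sort]
  simp

lemma coheight_ne_zero (i : ι) : coheight b i ≠ 0 := b.flip.height_ne_zero i

variable [P.IsRootSystem]

/-- The half-sum `ρ` of the positive roots, characterised by `(ρ, α_j^∨) = 1`. -/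
def rho : V := P.toPerfPair.symm (b.toCoweightBasis.constr ℝ fun _ => (1 : ℝ))

lemma coroot'_rho_simple (j : b.support) : P.coroot' (j : ι) (rho b) = 1 := by
  have h : P.toPerfPair (rho b) (P.coroot j) = 1 := by
    rw [rho, LinearEquiv.apply_symm_apply, ← b.toCoweightBasis_apply,
      Module.Basis.constr_basis]
  exact h

lemma coroot'_rho (i : ι) : P.coroot' i (rho b) = coheight b i := by
  obtain ⟨f, -, -, hf⟩ := b.flip.exists_root_eq_sum_int i
  have h : P.coroot i = ∑ j ∈ b.support, f j • P.coroot j := hf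
  have h2 : coheight b i = ∑ j ∈ b.support, f j := RootPairing.Base.height_eq_sum hf
  have h3 : ∀ j : b.support, P.toLinearMap (rho b) (P.coroot j) = 1 := coroot'_rho_simple b
  change P.toLinearMap (rho b) (P.coroot i) = _
  rw [h, h2, map_sum, ← Finset.sum_coe_sort, ← Finset.sum_coe_sort b.support f]
  simp [h3]

lemma eq_of_simple_coroot'_eq {x y : V}
    (h : ∀ j : b.support, P.coroot' (j : ι) x = P.coroot' (j : ι) y) : x = y := by
  apply P.toPerfPair.injective
  apply b.toCoweightBasis.ext
  intro j
  rw [b.toCoweightBasis_apply]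
  exact h j

lemma coheight_simple (j : b.support) : coheight b j = 1 := by
  have h := coroot'_rho_simple b j
  rw [coroot'_rho] at h
  exact_mod_cast h

lemma coheight_negRoot (i : ι) : coheight b (negRoot P i) = - coheight b i := by
  have h := coroot'_negRoot P i (rho b)
  rw [coroot'_rho, coroot'_rho] at h
  exact_mod_cast h

lemma coheight_rootRefl_smul [P.IsCrystallographic] (i j : ι) :
    coheight b (rootRefl P i • j) = coheight b j - coheight b i * P.pairingIn ℤ i j := by
  have h := coroot'_rootRefl_index P i j (rho b)
  rw [coroot'_rho, coroot'_rho, coroot'_rho, coroot'_root] at h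
  exact_mod_cast h

variable [Finite ι] [P.IsIrreducible]

lemma coheight_le_theta (i : ι) : coheight b i ≤ coheight b (theta b) :=
  (exists_highest P b).choose_spec i

lemma coheight_theta : coheight b (theta b) = coxeterNumber b - 1 := by
  simp [coxeterNumber]

lemma coheight_lt (i : ι) : coheight b i < coxeterNumber b := by
  have := coheight_le_theta b i
  have := coheight_theta b
  lia

lemma neg_lt_coheight (i : ι) : - coxeterNumber b < coheight b i := by
  have h := coheight_lt b (negRoot P i)
  rw [coheight_negRoot] at h
  lia

lemma support_nonempty : b.support.Nonempty := by
  have : Nonempty ι := ⟨theta b⟩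
  exact b.support_nonempty

lemma two_le_coxeterNumber : 2 ≤ coxeterNumber b := by
  obtain ⟨j, hj⟩ := support_nonempty b
  have h := coheight_lt b j
  rw [coheight_simple b ⟨j, hj⟩] at h
  lia

variable [P.IsCrystallographic]

/-- Dominance of `θ^∨`: otherwise `s_j` would raise the maximal coheight. -/
lemma pairingIn_theta_nonneg (j : b.support) : 0 ≤ P.pairingIn ℤ j (theta b) := by
  have h := coheight_le_theta b (rootRefl P (j : ι) • theta b)
  rw [coheight_rootRefl_smul, coheight_simple] at h
  lia

variable [P.IsReduced]

lemma isPos_theta : b.IsPos (theta b) := by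
  rw [← coheight_pos_iff, coheight_theta]
  have := two_le_coxeterNumber b
  lia

lemma theta_pairingIn_nonneg {i : ι} (hi : b.IsPos i) : 0 ≤ P.pairingIn ℤ (theta b) i := by
  obtain ⟨f, hf, h⟩ := exists_coroot'_eq_sum b hi
  have h1 := h (P.root (theta b))
  rw [coroot'_root] at h1
  have h2 : (0 : ℝ) ≤ P.pairingIn ℤ (theta b) i := by
    rw [h1]
    refine Finset.sum_nonneg fun j _ => mul_nonneg (by exact_mod_cast hf j) ?_
    rw [coroot'_root]
    have h3 : ¬ P.pairingIn ℤ (theta b) j < 0 := by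
      rw [P.pairingIn_lt_zero_iff ℤ]
      exact not_lt.mpr (pairingIn_theta_nonneg b j)
    exact_mod_cast not_lt.mp h3
  exact_mod_cast h2

/-- This confines `s_0` to a single wall of the fundamental alcove. The reason is that every
coheight lies strictly between `-h` and `h`, while `s_θ` lowers the coheight of `i` by `(h - 1)(θ,
i^∨)`. -/
lemma theta_pairingIn_le_one {i : ι} (hi : i ≠ theta b) : P.pairingIn ℤ (theta b) i ≤ 1 := by
  by_contra! hn
  set n := P.pairingIn ℤ (theta b) i with hndef
  have h1 := neg_lt_coheight b (rootRefl P (theta b) • i)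
  have h2 := coheight_lt b i
  have h3 := two_le_coxeterNumber b
  rw [coheight_rootRefl_smul, ← hndef, coheight_theta] at h1
  -- For `n ≥ 3` the coheight of `s_θ(i)` would be at most `-2(h - 1) ≤ -h`. With `n = 2`, the root
  -- `i` must have the same coheight as `θ`.
  have hn2 : n = 2 := by
    by_contra hne
    have : 3 ≤ n := by lia
    nlinarith
  rw [hn2] at h1
  have h4 : coheight b i = coxeterNumber b - 1 := by lia
  have h5 : 0 < P.pairingIn ℤ i (theta b) := by
    rw [P.zero_lt_pairingIn_iff' ℤ]
    lia
  have h6 := neg_lt_coheight b (rootRefl P i • theta b)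
  rw [coheight_rootRefl_smul, h4, coheight_theta] at h6
  have h7 : P.pairingIn ℤ i (theta b) ≤ 2 := by
    by_contra! h
    nlinarith
  have h8 : P.pairingIn ℤ i (theta b) ≠ 1 := by
    intro h
    apply coheight_ne_zero b (rootRefl P i • theta b)
    rw [coheight_rootRefl_smul, h4, coheight_theta, h]
    ring
  have h9 : P.pairingIn ℤ i (theta b) = 2 := by lia
  have h10 : P.pairingIn ℤ (theta b) i = 2 := hndef.symm.trans hn2
  -- In a reduced system two roots that are neither equal nor opposite cannot have both pairings
  -- equal to `2`.
  have h11 := P.pairingIn_pairingIn_mem_set_of_isCrystal_of_isRed' i (theta b)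
    (fun h => hi (P.root.injective h)) (fun h => by
      have h12 := congrArg (P.coroot' (theta b)) h
      rw [map_neg, coroot'_root, coroot'_root_self, h9] at h12
      norm_num at h12)
  rw [h9, h10] at h11
  simp at h11

/-- Full support of `θ^∨` spreads along the connected Dynkin diagram: if `α_i^∨` occurs and a
neighbour `α_j^∨` does not, then `(α_j, θ^∨)` is a sum of nonpositive terms with a negative one,
against dominance. -/
lemma exists_coroot'_theta_eq_sum :
    ∃ f : b.support → ℤ, (∀ j, 1 ≤ f j) ∧ (∑ j, f j = coxeterNumber b - 1) ∧
      ∀ x, P.coroot' (theta b) x = ∑ j, (f j : ℝ) * P.coroot' (j : ι) x := by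
  obtain ⟨f, hf, h⟩ := exists_coroot'_eq_sum b (isPos_theta b)
  have hsum : ∑ j, f j = coxeterNumber b - 1 := by
    have h1 := h (rho b)
    rw [coroot'_rho, coheight_theta] at h1
    simp only [coroot'_rho_simple, mul_one] at h1
    exact_mod_cast h1.symm
  refine ⟨f, fun j => ?_, hsum, h⟩
  obtain ⟨i, hi⟩ : ∃ i, 1 ≤ f i := by
    by_contra! hn
    have h1 : ∑ j, f j ≤ 0 := Finset.sum_nonpos fun j _ => by have := hn j; lia
    have := two_le_coxeterNumber b
    lia
  refine b.induction_on_cartanMatrix (fun j => 1 ≤ f j) hi fun i j hi hij => ?_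
  by_contra hj
  have hj0 : f j = 0 := le_antisymm (by lia) (hf j)
  have h1 := h (P.root j)
  have h2 := pairingIn_theta_nonneg b j
  have h3 : ∀ k : b.support, (f k : ℝ) * P.coroot' (k : ι) (P.root j) ≤ 0 := by
    intro k
    rcases eq_or_ne j k with rfl | hjk
    · simp [hj0]
    · rw [coroot'_root]
      refine mul_nonpos_of_nonneg_of_nonpos (by exact_mod_cast hf k) ?_
      exact_mod_cast b.pairingIn_le_zero_of_ne (fun h => hjk (Subtype.ext h)) j.2 k.2
  have hne : j ≠ i := by
    rintro rfl
    exact hj hi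
  have h4 : (f i : ℝ) * P.coroot' (i : ι) (P.root j) < 0 := by
    rw [coroot'_root]
    refine mul_neg_of_pos_of_neg (by exact_mod_cast hi) ?_
    have h5 := b.pairingIn_le_zero_of_ne (fun h => hne (Subtype.ext h)) j.2 i.2
    have h6 : P.pairingIn ℤ j i ≠ 0 := hij
    exact_mod_cast lt_of_le_of_ne h5 h6
  have h7 : P.coroot' (theta b) (P.root j) < 0 := by
    rw [h1]
    exact Finset.sum_neg' (fun k _ => h3 k) ⟨i, Finset.mem_univ _, h4⟩
  rw [coroot'_root] at h7
  have : P.pairingIn ℤ j (theta b) < 0 := by exact_mod_cast h7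
  lia

end Heights

/-! ### Central points of alcoves and adjacency -/

section Alcoves

variable {ι V N : Type*} [AddCommGroup V] [Module ℝ V] [AddCommGroup N] [Module ℝ N]
  {P : RootPairing ι ℝ V N}

lemma smul_mem_weightLattice_zsmul (n : ℤ) {x : V} (hx : x ∈ weightLattice P) :
    (n : ℝ) • x ∈ weightLattice P := by
  rw [Int.cast_smul_eq_zsmul]
  exact (weightLattice P).zsmul_mem hx n

variable [P.IsRootSystem] (b : P.Base)

lemma rho_mem : rho b ∈ weightLattice P := fun i => ⟨coheight b i, (coroot'_rho b i).symm⟩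

variable [Finite ι] [P.IsIrreducible]

lemma one_lt_coxeterNumber : (1 : ℝ) < coxeterNumber b := by
  have := two_le_coxeterNumber b
  exact_mod_cast this

lemma coxeterNumber_pos : (0 : ℝ) < coxeterNumber b :=
  zero_lt_one.trans (one_lt_coxeterNumber b)

lemma inv_coxeterNumber_pos : 0 < (coxeterNumber b : ℝ)⁻¹ := inv_pos.mpr (coxeterNumber_pos b)

lemma inv_coxeterNumber_lt_one : (coxeterNumber b : ℝ)⁻¹ < 1 :=
  inv_lt_one_of_one_lt₀ (one_lt_coxeterNumber b)

/-- The central point `ρ/h` of the fundamental alcove. -/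
def center : V := (coxeterNumber b : ℝ)⁻¹ • rho b

lemma coroot'_center (i : ι) :
    P.coroot' i (center b) = (coxeterNumber b : ℝ)⁻¹ * coheight b i := by
  rw [center, map_smul, coroot'_rho, smul_eq_mul]

lemma coroot'_center_lt_one (i : ι) : P.coroot' i (center b) < 1 := by
  rw [coroot'_center, inv_mul_lt_one₀ (coxeterNumber_pos b)]
  exact_mod_cast coheight_lt b i

lemma center_mem : center b ∈ scaledLattice b := ⟨rho b, rho_mem b, rfl⟩

lemma inv_smul_mem_scaledLattice {x : V} (hx : x ∈ weightLattice P) :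
    (coxeterNumber b : ℝ)⁻¹ • x ∈ scaledLattice b := ⟨x, hx, rfl⟩

/-- The points `w(ρ/h) + μ`, `μ ∈ Λ`; these are the central points of the alcoves. -/
def centralPoints : Set V :=
  {q | ∃ w : P.weylGroup, ∃ μ ∈ weightLattice P, q = w • center b + μ}

variable {b}

lemma center_mem_centralPoints : center b ∈ centralPoints b :=
  ⟨1, 0, zero_mem _, by rw [one_smul, add_zero]⟩

lemma add_mem_centralPoints {q μ : V} (hq : q ∈ centralPoints b) (hμ : μ ∈ weightLattice P) :
    q + μ ∈ centralPoints b := by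
  obtain ⟨w, ν, hν, rfl⟩ := hq
  exact ⟨w, ν + μ, add_mem hν hμ, add_assoc _ _ _⟩

lemma exists_coroot'_eq {q : V} (hq : q ∈ centralPoints b) (i : ι) :
    ∃ (n : ℤ) (j : ι), P.coroot' i q = n + P.coroot' j (center b) := by
  obtain ⟨w, μ, hμ, rfl⟩ := hq
  obtain ⟨n, hn⟩ := hμ i
  exact ⟨n, w⁻¹ • i, by rw [map_add, coroot'_smul, hn, add_comm]⟩

lemma exists_mul_coroot'_eq {q : V} (hq : q ∈ centralPoints b) (i : ι) :
    ∃ n : ℤ, (coxeterNumber b : ℝ) * P.coroot' i q = n := by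
  obtain ⟨n, j, h⟩ := exists_coroot'_eq hq i
  refine ⟨coxeterNumber b * n + coheight b j, ?_⟩
  rw [h, coroot'_center, mul_add, mul_inv_cancel_left₀ (coxeterNumber_ne_zero b)]
  push_cast
  ring

variable [P.IsCrystallographic]

variable (b) in
lemma smul_mem_scaledLattice (w : P.weylGroup) {x : V} (hx : x ∈ scaledLattice b) :
    w • x ∈ scaledLattice b := by
  obtain ⟨y, hy, rfl⟩ := hx
  exact ⟨w • y, smul_mem_weightLattice P w hy, (weyl_smul_smul P w _ y).symm⟩

lemma smul_mem_centralPoints (w : P.weylGroup) {q : V} (hq : q ∈ centralPoints b) :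
    w • q ∈ centralPoints b := by
  obtain ⟨u, ν, hν, rfl⟩ := hq
  exact ⟨w * u, w • ν, smul_mem_weightLattice P w hν, by rw [weyl_smul_add, mul_smul]⟩

lemma centralPoints_subset {q : V} (hq : q ∈ centralPoints b) : q ∈ scaledLattice b := by
  obtain ⟨w, μ, hμ, rfl⟩ := hq
  exact add_mem (smul_mem_scaledLattice b w (center_mem b)) (weightLattice_le_scaledLattice b hμ)

variable [P.IsReduced]

variable (b) in
lemma coroot'_center_pos {i : ι} (hi : b.IsPos i) : 0 < P.coroot' i (center b) := by
  rw [coroot'_center]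
  exact mul_pos (inv_coxeterNumber_pos b) (by exact_mod_cast (coheight_pos_iff b i).mpr hi)

/-- Modulo integers the value is a coheight divided by `h`, and coheights are nonzero and smaller
than `h` in absolute value. So no central point lies on a wall. -/
lemma coroot'_ne_intCast {q : V} (hq : q ∈ centralPoints b) (i : ι) (n : ℤ) :
    P.coroot' i q ≠ n := by
  obtain ⟨m, j, h⟩ := exists_coroot'_eq hq i
  rw [h]
  intro h2
  have h3 : P.coroot' j (center b) = ((n - m : ℤ) : ℝ) := by push_cast; linarith
  by_cases hj : b.IsPos j
  · have h4 := coroot'_center_pos b hj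
    have h5 := coroot'_center_lt_one b j
    rw [h3] at h4 h5
    norm_cast at h4 h5
    lia
  · rw [← isPos_negRoot] at hj
    have h4 := coroot'_center_pos b hj
    have h5 := coroot'_center_lt_one b (negRoot P j)
    rw [coroot'_negRoot, h3] at h4 h5
    norm_cast at h4 h5
    lia

/-- The numbers `n_j = h (q, α_j^∨)` are positive integers with `∑ f_j n_j < h = 1 + ∑ f_j`, where
the `f_j ≥ 1` are the coefficients of `θ^∨`. This leaves only `n_j = 1` for all `j`, which is `ρ/h`.
-/
lemma eq_center_of_simple {q : V} (hq : q ∈ centralPoints b)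
    (h0 : ∀ j : b.support, 0 < P.coroot' (j : ι) q) (h1 : P.coroot' (theta b) q < 1) :
    q = center b := by
  have hh := coxeterNumber_pos b
  choose n hn using fun j : b.support => exists_mul_coroot'_eq hq (j : ι)
  obtain ⟨f, hf, hsum, hθ⟩ := exists_coroot'_theta_eq_sum b
  have hn1 : ∀ j, 1 ≤ n j := by
    intro j
    have : (0 : ℝ) < n j := by rw [← hn]; exact mul_pos hh (h0 j)
    have : 0 < n j := by exact_mod_cast this
    lia
  have h2 : ∑ j, f j * n j < coxeterNumber b := by
    have h3 : (coxeterNumber b : ℝ) * P.coroot' (theta b) q < coxeterNumber b := by nlinarith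
    rw [hθ, Finset.mul_sum] at h3
    have h4 : ∀ j, (coxeterNumber b : ℝ) * ((f j : ℝ) * P.coroot' (j : ι) q) = f j * n j := by
      intro j
      rw [← hn]
      ring
    simp only [h4] at h3
    exact_mod_cast h3
  have h5 : ∀ j, n j = 1 := by
    intro j
    by_contra hne
    have h6 : ∑ j, f j * 1 < ∑ j, f j * n j := by
      refine Finset.sum_lt_sum (fun i _ => ?_) ⟨j, Finset.mem_univ _, ?_⟩
      · have := hf i; have := hn1 i; nlinarith
      · have := hf j
        have : 1 < n j := lt_of_le_of_ne (hn1 j) (Ne.symm hne)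
        nlinarith
    simp only [mul_one, hsum] at h6
    lia
  apply eq_of_simple_coroot'_eq b
  intro j
  have h6 := hn j
  rw [h5 j] at h6
  rw [coroot'_center, coheight_simple]
  field_simp
  rw [mul_comm]
  simpa using h6

lemma eq_center_of_mem_fundamentalAlcove {q : V} (hq : q ∈ centralPoints b)
    (h : q ∈ fundamentalAlcove b) : q = center b :=
  eq_center_of_simple hq (fun j => (h j (b.isPos_of_mem_support j.2)).1)
    (h _ (isPos_theta b)).2

variable (b) in
lemma center_mem_fundamentalAlcove : center b ∈ fundamentalAlcove b :=
  fun i hi => ⟨coroot'_center_pos b hi, coroot'_center_lt_one b i⟩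

/-- The central point `q - β/h`, adjacent to `q` across a wall orthogonal to `β`. -/
def cross (b : P.Base) (q : V) (β : ι) : V := q - (coxeterNumber b : ℝ)⁻¹ • P.root β

/-- The central point `q` is separated from `cross b q β` by the wall `(x, β^∨) = k` and by no
other one. -/
def Crosses (b : P.Base) (q : V) (β : ι) (k : ℤ) : Prop :=
  P.coroot' β q = k + (coxeterNumber b : ℝ)⁻¹ ∧
    ∀ γ, γ ≠ β → γ ≠ negRoot P β → ∃ n : ℤ,
      (n < P.coroot' γ q ∧ P.coroot' γ q < n + 1) ∧
      (n < P.coroot' γ (cross b q β) ∧ P.coroot' γ (cross b q β) < n + 1)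

end Alcoves

/-! ### Paths of adjacent central points and decompositions in the affine Weyl group -/

section Paths

variable {ι V N : Type*} [AddCommGroup V] [Module ℝ V] [AddCommGroup N] [Module ℝ N]
  {P : RootPairing ι ℝ V N}

lemma affineReflection_apply (i : ι) (k : ℤ) (x : V) :
    affineReflection P i k x = rootRefl P i • x + (k : ℝ) • P.root i := by
  change x - (P.coroot' i x - (k : ℝ)) • P.root i = _
  rw [rootRefl_smul]
  module

/-- Reflecting `q` in a wall that separates it from `p` brings it nearer to `p`. -/
lemma sum_sq_affineReflection_lt [Fintype ι] {p q : V} {i : ι} {k : ℤ}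
    (hp : k < P.coroot' i p) (hq : P.coroot' i q < k) :
    ∑ γ, P.coroot' γ (affineReflection P i k q - p) ^ 2 < ∑ γ, P.coroot' γ (q - p) ^ 2 := by
  have hB : ∀ x : V, ∑ γ, P.coroot' γ x ^ 2 = P.RootForm x x := by
    intro x
    rw [RootPairing.rootForm_apply_apply]
    exact Finset.sum_congr rfl fun γ _ => sq _
  set t := P.coroot' i q - k with ht
  have hs : affineReflection P i k q - p = (q - p) - t • P.root i := by
    change q - t • P.root i - p = _
    abel
  have h1 : 0 < P.RootForm (P.root i) (P.root i) := by
    rw [← hB]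
    refine Finset.sum_pos' (fun γ _ => sq_nonneg _) ⟨i, Finset.mem_univ _, ?_⟩
    rw [coroot'_root_self]
    norm_num
  have hsymm : ∀ x y, P.RootForm x y = P.RootForm y x := fun x y => by
    simp [RootPairing.rootForm_apply_apply, mul_comm]
  -- Invariance of the form under `s_i` turns the coroot into an inner product with the root.
  have h2 : 2 * P.RootForm (q - p) (P.root i) =
      P.coroot' i (q - p) * P.RootForm (P.root i) (P.root i) := by
    have h3 := P.rootForm_reflection_reflection_apply i (q - p) (P.root i)
    rw [RootPairing.reflection_apply_self, RootPairing.reflection_apply, map_neg, map_sub,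
      map_smul] at h3
    simp only [LinearMap.sub_apply, LinearMap.smul_apply, smul_eq_mul] at h3
    linarith
  rw [hs, hB, hB]
  simp only [map_sub, map_smul, LinearMap.sub_apply, LinearMap.smul_apply, smul_eq_mul] at h2 ⊢
  rw [hsymm (P.root i) q, hsymm (P.root i) p]
  have h4 : t * (k - P.coroot' i p) * P.RootForm (P.root i) (P.root i) > 0 :=
    mul_pos (mul_pos_of_neg_of_neg (by linarith) (by linarith)) h1
  nlinarith

/-- Apart from the generators themselves, the only fact about `W_aff` that is needed: its elements
lie in the extended group of maps `x ↦ w(x) + μ` with `μ ∈ Λ`. -/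
lemma exists_apply_eq_of_mem_affineWeylGroup [P.IsCrystallographic]
    {v : Equiv.Perm V} (hv : v ∈ affineWeylGroup P) :
    ∃ w : P.weylGroup, ∃ μ ∈ weightLattice P, ∀ x, v x = w • x + μ := by
  induction hv using Subgroup.closure_induction with
  | mem v hv =>
    obtain ⟨i, k, rfl⟩ := hv
    exact ⟨rootRefl P i, _, smul_mem_weightLattice_zsmul k (root_mem_weightLattice P i),
      affineReflection_apply i k⟩
  | one => exact ⟨1, 0, zero_mem _, fun x => by simp⟩
  | mul v v' _ _ h h' =>
    obtain ⟨w, μ, hμ, h⟩ := h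
    obtain ⟨w', μ', hμ', h'⟩ := h'
    refine ⟨w * w', w • μ' + μ, add_mem (smul_mem_weightLattice P w hμ') hμ, fun x => ?_⟩
    rw [Equiv.Perm.mul_apply, h, h', weyl_smul_add, mul_smul, add_assoc]
  | inv v _ h =>
    obtain ⟨w, μ, hμ, h⟩ := h
    refine ⟨w⁻¹, -(w⁻¹ • μ), neg_mem (smul_mem_weightLattice P _ hμ), fun x => ?_⟩
    rw [Equiv.Perm.inv_eq_iff_eq, h, ← sub_eq_add_neg, weyl_smul_sub, smul_inv_smul,
      smul_inv_smul, sub_add_cancel]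

variable [Finite ι] [P.IsRootSystem] [P.IsIrreducible] {b : P.Base}

lemma cross_smul_add (w : P.weylGroup) (q μ : V) (β : ι) :
    cross b (w • q + μ) (w • β) = w • cross b q β + μ := by
  rw [cross, cross, weyl_smul_sub, weyl_smul_smul, root_smul]
  abel

lemma cross_add (q μ : V) (β : ι) : cross b (q + μ) β = cross b q β + μ := by
  rw [cross, cross]
  abel

lemma cross_cross_negRoot (q : V) (β : ι) : cross b (cross b q β) (negRoot P β) = q := by
  rw [cross, cross, root_negRoot, smul_neg]
  abel

lemma cross_eq {q : V} {β : ι} {k : ℤ} (h : P.coroot' β q = k + (coxeterNumber b : ℝ)⁻¹) :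
    cross b q β = rootRefl P β • q + (k : ℝ) • P.root β := by
  rw [cross, rootRefl_smul, h]
  module

lemma coroot'_cross {q : V} {β : ι} {k : ℤ} (h : P.coroot' β q = k + (coxeterNumber b : ℝ)⁻¹) :
    P.coroot' β (cross b q β) = k - (coxeterNumber b : ℝ)⁻¹ := by
  rw [cross, map_sub, map_smul, h, coroot'_root_self, smul_eq_mul]
  ring

lemma Crosses.smul_add {q : V} {β : ι} {k : ℤ} (h : Crosses b q β k) (w : P.weylGroup) {μ : V}
    (hμ : μ ∈ weightLattice P) {k' : ℤ} (hk : P.coroot' (w • β) μ = k' - k) :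
    Crosses b (w • q + μ) (w • β) k' := by
  refine ⟨by rw [map_add, coroot'_smul_smul, h.1, hk]; ring, fun γ h1 h2 => ?_⟩
  obtain ⟨n, ⟨h3, h4⟩, h5, h6⟩ := h.2 (w⁻¹ • γ)
    (fun e => h1 (by rw [← e, smul_inv_smul]))
    (fun e => h2 (by rw [← smul_negRoot, ← e, smul_inv_smul]))
  obtain ⟨m, hm⟩ := hμ γ
  refine ⟨n + m, ?_⟩
  rw [cross_smul_add, map_add, map_add, coroot'_smul, coroot'_smul, ← hm]
  push_cast
  exact ⟨⟨by linarith, by linarith⟩, by linarith, by linarith⟩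

lemma Crosses.add {q : V} {β : ι} {k : ℤ} (h : Crosses b q β k) {μ : V}
    (hμ : μ ∈ weightLattice P) {k' : ℤ} (hk : P.coroot' β μ = k' - k) :
    Crosses b (q + μ) β k' := by
  have h1 := h.smul_add (1 : P.weylGroup) hμ (k' := k') (by rwa [one_smul])
  rwa [one_smul, one_smul] at h1

lemma Crosses.symm {q : V} {β : ι} {k : ℤ} (h : Crosses b q β k) :
    Crosses b (cross b q β) (negRoot P β) (-k) := by
  refine ⟨?_, fun γ h1 h2 => ?_⟩
  · rw [coroot'_negRoot, coroot'_cross h.1]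
    push_cast
    ring
  · rw [negRoot_negRoot] at h2
    rw [cross_cross_negRoot]
    obtain ⟨n, h3, h4⟩ := h.2 γ h2 h1
    exact ⟨n, h4, h3⟩

/-- `β_1, …, β_l` is the sequence of roots crossed along a path of adjacent central points from `q`
to the central point of the fundamental alcove. -/
def IsPath (b : P.Base) : V → List ι → Prop
  | q, [] => q = center b
  | q, β :: l => (∃ k, Crosses b q β k) ∧ IsPath b (cross b q β) l

/-- The generator `s_i` of the affine Weyl group is the reflection in the wall
`(x, α_i^∨) = genLevel b i`. -/
def genLevel (b : P.Base) : Option b.support → ℤ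
  | none => -1
  | some _ => 0

lemma affineGen_eq (o : Option b.support) :
    affineGen b o = affineReflection P (alpha b o) (genLevel b o) := by
  cases o <;> rfl

lemma coroot'_alpha_center (o : Option b.support) :
    P.coroot' (alpha b o) (center b) = genLevel b o + (coxeterNumber b : ℝ)⁻¹ := by
  have h := coxeterNumber_ne_zero b
  cases o with
  | none =>
    rw [alpha, coroot'_negRoot, coroot'_center, coheight_theta, genLevel]
    push_cast
    field_simp
    ring
  | some j =>
    rw [alpha, coroot'_center, coheight_simple, genLevel]
    simp

lemma affineGen_apply (o : Option b.support) (x : V) :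
    affineGen b o x = rootRefl P (alpha b o) • x + (genLevel b o : ℝ) • P.root (alpha b o) := by
  rw [affineGen_eq, affineReflection_apply]

lemma affineGen_center (o : Option b.support) :
    affineGen b o (center b) = cross b (center b) (alpha b o) := by
  rw [affineGen_apply, cross_eq (coroot'_alpha_center o)]

lemma affineGen_prod_mem (l : List (Option b.support)) :
    (l.map (affineGen b)).prod ∈ affineWeylGroup P := by
  refine Subgroup.list_prod_mem _ fun v hv => ?_
  obtain ⟨o, -, rfl⟩ := List.mem_map.mp hv
  exact Subgroup.subset_closure ⟨_, _, affineGen_eq o⟩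

/-- The squared distance to `ρ/h`, scaled by `h²`, serves as the termination measure in
`exists_word_center`. -/
lemma exists_nat_sum_sq [Fintype ι] {q : V} (hq : q ∈ centralPoints b) :
    ∃ n : ℕ, (coxeterNumber b : ℝ) ^ 2 * ∑ γ, P.coroot' γ (q - center b) ^ 2 = n := by
  choose n hn using fun γ => exists_mul_coroot'_eq hq γ
  choose m hm using fun γ => exists_mul_coroot'_eq (center_mem_centralPoints (b := b)) γ
  refine ⟨(∑ γ, (n γ - m γ) ^ 2).toNat, ?_⟩
  have h : ((∑ γ, (n γ - m γ) ^ 2).toNat : ℤ) = ∑ γ, (n γ - m γ) ^ 2 :=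
    Int.toNat_of_nonneg (Finset.sum_nonneg fun γ _ => sq_nonneg _)
  have h2 : ((∑ γ, (n γ - m γ) ^ 2).toNat : ℝ) = ((∑ γ, (n γ - m γ) ^ 2 : ℤ) : ℝ) := by
    exact_mod_cast congrArg (Int.cast (R := ℝ)) h
  rw [h2, Finset.mul_sum]
  push_cast
  refine Finset.sum_congr rfl fun γ _ => ?_
  rw [← hn, ← hm, map_sub]
  ring

variable [P.IsCrystallographic]

lemma cross_mem_centralPoints {q : V} (hq : q ∈ centralPoints b) {β : ι} {k : ℤ}
    (h : Crosses b q β k) : cross b q β ∈ centralPoints b := by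
  rw [cross_eq h.1]
  exact add_mem_centralPoints (smul_mem_centralPoints _ hq)
    (smul_mem_weightLattice_zsmul k (root_mem_weightLattice P β))

lemma affineReflection_mem (i : ι) (k : ℤ) {q : V} (hq : q ∈ centralPoints b) :
    affineReflection P i k q ∈ centralPoints b := by
  rw [affineReflection_apply]
  exact add_mem_centralPoints (smul_mem_centralPoints _ hq)
    (smul_mem_weightLattice_zsmul k (root_mem_weightLattice P i))

variable [P.IsReduced]

/-- A generator of `W_aff` moves `ρ/h` across its own wall only. For `s_j` with `j ≥ 1` this holds
since `s_j` permutes the other positive roots. For `s_0` the value becomes `(ρ/h, γ^∨) - n (ρ/h,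
θ^∨) + n` with `n = (θ, γ^∨) ∈ {0, 1}`. -/
lemma coroot'_affineGen_center_mem {γ : ι} (hγ : b.IsPos γ) {o : Option b.support}
    (h1 : γ ≠ alpha b o) (h2 : γ ≠ negRoot P (alpha b o)) :
    0 < P.coroot' γ (affineGen b o (center b)) ∧ P.coroot' γ (affineGen b o (center b)) < 1 := by
  rw [affineGen_apply, map_add, LinearMap.map_smul, coroot'_smul, rootRefl_inv]
  cases o with
  | some j =>
    have h3 := isPos_rootRefl_smul b j hγ h1
    simpa [genLevel] using! And.intro (coroot'_center_pos b h3) (coroot'_center_lt_one b _)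
  | none =>
    have hne : γ ≠ theta b := by
      intro h
      apply h2
      rw [alpha, negRoot_negRoot, h]
    have h3 := theta_pairingIn_nonneg b hγ
    have h4 := theta_pairingIn_le_one b hne
    have h5 : P.coroot' γ (P.root (alpha b none)) = - (P.pairingIn ℤ (theta b) γ : ℝ) := by
      rw [alpha, root_negRoot, map_neg, coroot'_root]
    have h6 : rootRefl P (alpha b none) = rootRefl P (theta b) := rootRefl_negRoot P _
    have h7 := coroot'_rootRefl_index P (theta b) γ (center b)
    rw [coroot'_root] at h7
    have h8 := coheight_ne_zero b (rootRefl P (theta b) • γ)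
    have h9 := coheight_le_theta b γ
    have hγ' := (coheight_pos_iff b γ).mpr hγ
    rw [coheight_rootRefl_smul] at h8
    rw [h5, h6, h7, genLevel]
    have h10 := coroot'_center_pos b hγ
    have h11 := coroot'_center_lt_one b γ
    have h12 := coroot'_center_lt_one b (theta b)
    rcases (by lia : P.pairingIn ℤ (theta b) γ = 0 ∨ P.pairingIn ℤ (theta b) γ = 1) with h | h
    · rw [h]
      simpa using! And.intro h10 h11
    · rw [h] at h8 ⊢
      have h13 : P.coroot' γ (center b) < P.coroot' (theta b) (center b) := by
        rw [coroot'_center, coroot'_center]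
        refine mul_lt_mul_of_pos_left ?_ (inv_coxeterNumber_pos b)
        -- Equal coheights would give `s_θ(γ)` the coheight zero, which no root has.
        have h14 := lt_of_le_of_ne h9 (by lia)
        exact_mod_cast h14
      simp only [smul_eq_mul]
      push_cast
      exact ⟨by linarith, by linarith⟩

lemma crosses_center (o : Option b.support) :
    Crosses b (center b) (alpha b o) (genLevel b o) := by
  refine ⟨coroot'_alpha_center o, fun γ h1 h2 => ?_⟩
  rw [← affineGen_center]
  by_cases hγ : b.IsPos γ
  · obtain ⟨h3, h4⟩ := coroot'_affineGen_center_mem hγ h1 h2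
    exact ⟨0, by simpa using ⟨coroot'_center_pos b hγ, coroot'_center_lt_one b γ⟩,
      by simpa using ⟨h3, h4⟩⟩
  · rw [← isPos_negRoot] at hγ
    obtain ⟨h3, h4⟩ := coroot'_affineGen_center_mem (o := o) hγ
      (fun h => h2 (by rw [← h, negRoot_negRoot]))
      (fun h => h1 (by rw [← negRoot_negRoot P γ, h, negRoot_negRoot]))
    have h5 := coroot'_center_pos b hγ
    have h6 := coroot'_center_lt_one b (negRoot P γ)
    rw [coroot'_negRoot] at h3 h4 h5 h6
    refine ⟨-1, ?_⟩
    push_cast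
    exact ⟨⟨by linarith, by linarith⟩, by linarith, by linarith⟩

/-- The points `ρ/h, s_{i_1}(ρ/h), s_{i_1} s_{i_2}(ρ/h), …` form a path of adjacent central points.
An affine map `x ↦ w(x) + μ` carries it to another path, and allowing such a map makes the induction
on the word close up. -/
lemma isPath_of_word (l : List (Option b.support)) (w : P.weylGroup) {μ : V}
    (hμ : μ ∈ weightLattice P)
    (h : w • (l.map (affineGen b)).prod (center b) + μ = center b) :
    IsPath b (w • center b + μ) ((rootSequence b l).map (w • ·)) := by
  induction l generalizing w μ with
  | nil => exact h
  | cons o l ih =>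
    rw [rootSequence, List.map_cons, IsPath]
    refine ⟨?_, ?_⟩
    · obtain ⟨m, hm⟩ := hμ (w • alpha b o)
      exact ⟨genLevel b o + m, (crosses_center o).smul_add w hμ (by rw [← hm]; push_cast; ring)⟩
    · have h1 : ∀ x, w • affineGen b o x + μ = (w * rootRefl P (alpha b o)) • x +
          (w • ((genLevel b o : ℝ) • P.root (alpha b o)) + μ) := by
        intro x
        rw [affineGen_apply, weyl_smul_add, mul_smul, add_assoc]
      have h2 := smul_mem_weightLattice P w (smul_mem_weightLattice_zsmul (genLevel b o)
        (root_mem_weightLattice P (alpha b o)))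
      have h3 := ih (w * rootRefl P (alpha b o)) (add_mem h2 hμ) (by
        rw [← h1]
        exact h)
      rw [cross_smul_add, ← affineGen_center, h1, List.map_map]
      convert! h3 using 2

/-- If some generator's wall separates `q` from `ρ/h`, reflecting in it shortens the distance; if
none does, `q` is `ρ/h` by `eq_center_of_simple`. -/
lemma exists_word_center {q : V} (hq : q ∈ centralPoints b) :
    ∃ l : List (Option b.support), (l.map (affineGen b)).prod (center b) = q := by
  have : Fintype ι := Fintype.ofFinite ι
  obtain ⟨n, hn⟩ := exists_nat_sum_sq hq
  induction n using Nat.strong_induction_on generalizing q with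
  | _ n ih =>
    by_cases h : ∃ o, P.coroot' (alpha b o) q < genLevel b o
    · obtain ⟨o, ho⟩ := h
      have h1 := affineReflection_mem (b := b) (alpha b o) (genLevel b o) hq
      have h2 : (genLevel b o : ℝ) < P.coroot' (alpha b o) (center b) := by
        rw [coroot'_alpha_center]
        linarith [inv_coxeterNumber_pos b]
      have h3 := sum_sq_affineReflection_lt h2 ho
      obtain ⟨m, hm⟩ := exists_nat_sum_sq h1
      have h4 : m < n := by
        have h5 : (m : ℝ) < n := by
          rw [← hm, ← hn]
          exact mul_lt_mul_of_pos_left h3 (pow_pos (coxeterNumber_pos b) 2)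
        exact_mod_cast h5
      obtain ⟨l, hl⟩ := ih m h4 h1 hm
      refine ⟨o :: l, ?_⟩
      rw [List.map_cons, List.prod_cons, Equiv.Perm.mul_apply, hl, affineGen_eq]
      have h6 : affineReflection P (alpha b o) (genLevel b o)
          (affineReflection P (alpha b o) (genLevel b o) q) = q := by
        exact (affineReflection P (alpha b o) (genLevel b o)).left_inv q
      exact h6
    · push Not at h
      refine ⟨[], ?_⟩
      refine (eq_center_of_simple hq (fun j => ?_) ?_).symm
      · have h1 := h (some j)
        have h2 := coroot'_ne_intCast hq (j : ι) 0
        simp only [genLevel, alpha, Int.cast_zero] at h1 h2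
        exact lt_of_le_of_ne h1 (Ne.symm h2)
      · have h1 := h none
        have h2 := coroot'_ne_intCast hq (theta b) 1
        rw [genLevel, alpha, coroot'_negRoot] at h1
        push_cast at h1 h2
        exact lt_of_le_of_ne (by linarith) h2

lemma exists_isPath {q : V} (hq : q ∈ centralPoints b) : ∃ l, IsPath b q l := by
  obtain ⟨w, μ, hμ, rfl⟩ := hq
  obtain ⟨l, hl⟩ := exists_word_center (b := b) (q := w⁻¹ • (center b - μ))
    (smul_mem_centralPoints _ (by
      rw [sub_eq_add_neg]
      exact add_mem_centralPoints center_mem_centralPoints (neg_mem hμ)))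
  refine ⟨_, isPath_of_word l w hμ ?_⟩
  rw [hl, smul_inv_smul, sub_add_cancel]

/-- Comparing values at `ρ/h` forces the integer `(μ, γ^∨)` to be `0` or `1` according to the sign
of `w⁻¹(γ)`, and these are the values which keep the whole alcove in place. The map itself need not
be the identity. -/
lemma mem_fundamentalAlcove_of_apply_center (w : P.weylGroup) {μ : V}
    (hμ : μ ∈ weightLattice P) (h : w • center b + μ = center b) {x : V}
    (hx : x ∈ fundamentalAlcove b) : w • x + μ ∈ fundamentalAlcove b := by
  intro γ hγ
  obtain ⟨n, hn⟩ := hμ γ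
  have h1 := congrArg (P.coroot' γ) h
  rw [map_add, coroot'_smul, ← hn] at h1
  rw [map_add, coroot'_smul, ← hn]
  have h2 := coroot'_center_pos b hγ
  have h3 := coroot'_center_lt_one b γ
  by_cases hδ : b.IsPos (w⁻¹ • γ)
  · have h4 := coroot'_center_pos b hδ
    have h5 := coroot'_center_lt_one b (w⁻¹ • γ)
    have h6 : (-1 : ℝ) < n := by linarith
    have h7 : (n : ℝ) < 1 := by linarith
    norm_cast at h6 h7
    have h8 : n = 0 := by lia
    obtain ⟨h9, h10⟩ := hx _ hδ
    rw [h8]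
    simpa using! And.intro h9 h10
  · rw [← isPos_negRoot] at hδ
    have h4 := coroot'_center_pos b hδ
    have h5 := coroot'_center_lt_one b (negRoot P (w⁻¹ • γ))
    obtain ⟨h9, h10⟩ := hx _ hδ
    rw [coroot'_negRoot] at h4 h5 h9 h10
    have h6 : (0 : ℝ) < n := by linarith
    have h7 : (n : ℝ) < 2 := by linarith
    norm_cast at h6 h7
    have h8 : n = 1 := by lia
    rw [h8]
    push_cast
    exact ⟨by linarith, by linarith⟩

lemma IsTranslatingElement.apply_center {lam : weightLattice P} {v : Equiv.Perm V}
    (h : IsTranslatingElement b lam v) : v (center b) = center b - (lam : V) := by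
  obtain ⟨w, μ, hμ, hv⟩ := exists_apply_eq_of_mem_affineWeylGroup h.1
  have h1 : v (center b) ∈ (fun x => x - (lam : V)) '' fundamentalAlcove b := by
    rw [← h.2]
    exact ⟨_, center_mem_fundamentalAlcove b, rfl⟩
  obtain ⟨a, ha, h2⟩ := h1
  have h3 : a = w • center b + (μ + lam) := by
    rw [← add_assoc, ← hv, ← h2]
    simp
  have h4 : a = center b :=
    eq_center_of_mem_fundamentalAlcove ⟨w, _, add_mem hμ lam.2, h3⟩ ha
  rw [← h2, h4]

lemma isTranslatingElement_of_apply_center {lam : weightLattice P} {v : Equiv.Perm V}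
    (hv : v ∈ affineWeylGroup P) (h : v (center b) = center b - (lam : V)) :
    IsTranslatingElement b lam v := by
  refine ⟨hv, ?_⟩
  obtain ⟨w, μ, hμ, hw⟩ := exists_apply_eq_of_mem_affineWeylGroup hv
  have h1 : w • center b + (μ + lam) = center b := by
    rw [← add_assoc, ← hw, h, sub_add_cancel]
  have h2 : w⁻¹ • center b + - (w⁻¹ • (μ + (lam : V))) = center b := by
    nth_rw 1 [← h1]
    rw [weyl_smul_add, inv_smul_smul, add_neg_cancel_right]
  ext x
  constructor
  · rintro ⟨y, hy, rfl⟩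
    refine ⟨_, mem_fundamentalAlcove_of_apply_center w (add_mem hμ lam.2) h1 hy, ?_⟩
    change w • y + (μ + (lam : V)) - lam = v y
    rw [hw]
    abel
  · rintro ⟨y, hy, rfl⟩
    refine ⟨_, mem_fundamentalAlcove_of_apply_center w⁻¹
      (neg_mem (smul_mem_weightLattice P _ (add_mem hμ lam.2))) h2 hy, ?_⟩
    rw [hw, weyl_smul_add, smul_inv_smul, smul_neg, smul_inv_smul]
    change y + -(μ + (lam : V)) + μ = y - (lam : V)
    abel

lemma exists_isLambdaChain (lam : weightLattice P) : ∃ β : List ι, IsLambdaChain b lam β := by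
  obtain ⟨l, hl⟩ := exists_word_center (b := b) (q := center b - (lam : V)) (by
    rw [sub_eq_add_neg]
    exact add_mem_centralPoints center_mem_centralPoints (neg_mem lam.2))
  exact ⟨_, l, isTranslatingElement_of_apply_center (affineGen_prod_mem l) hl, rfl⟩

lemma IsLambdaChain.isPath {lam : weightLattice P} {β : List ι} (h : IsLambdaChain b lam β) :
    IsPath b (center b + (lam : V)) β := by
  obtain ⟨l, hl, rfl⟩ := h
  have h1 := isPath_of_word l (1 : P.weylGroup) lam.2 (by
    rw [hl.apply_center, one_smul, sub_add_cancel])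
  simpa using h1

end Paths

/-! ### Signed sums over integer intervals -/

section SignedSum

variable {A : Type*} [AddCommGroup A]

/-- The sum `f 1 + ⋯ + f n`, which for negative `n` is to be read as
`-(f 0 + f (-1) + ⋯ + f (n + 1))`. -/
def signedSum (f : ℤ → A) (n : ℤ) : A :=
  ∑ k ∈ Finset.Ico 0 n, f (k + 1) - ∑ k ∈ Finset.Ico n 0, f (k + 1)

lemma signedSum_eq_sub {f g : ℤ → A} (h : ∀ n, g (n + 1) - g n = f (n + 1)) (n : ℤ) :
    signedSum f n = g n - g 0 := by
  have h1 := int_telescope (fun k => - g k) n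
  have h2 : ∀ k, - g k - - g (k + 1) = f (k + 1) := fun k => by rw [← h]; abel
  simp only [h2] at h1
  rw [signedSum, h1]
  abel

/-- Writing a summand as a difference turns every identity between signed sums into a telescoping
one, valid for all signs of the bounds at once. -/
lemma exists_antidifference (f : ℤ → A) : ∃ g : ℤ → A, ∀ n, g (n + 1) - g n = f (n + 1) := by
  refine ⟨signedSum f, fun n => ?_⟩
  rw [signedSum, signedSum]
  rcases le_or_gt 0 n with hn | hn
  · have h1 : Finset.Ico 0 (n + 1) = insert n (Finset.Ico 0 n) := by
      ext x; simp only [Finset.mem_Ico, Finset.mem_insert]; lia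
    rw [h1, Finset.sum_insert (by simp), Finset.Ico_eq_empty (by lia : ¬ n + 1 < 0),
      Finset.Ico_eq_empty (by lia : ¬ n < 0)]
    abel
  · have h1 : Finset.Ico n 0 = insert n (Finset.Ico (n + 1) 0) := by
      ext x; simp only [Finset.mem_Ico, Finset.mem_insert]; lia
    rw [h1, Finset.sum_insert (by simp), Finset.Ico_eq_empty (by lia : ¬ 0 < n + 1),
      Finset.Ico_eq_empty (by lia : ¬ 0 < n)]
    abel

lemma signedSum_zero (f : ℤ → A) : signedSum f 0 = 0 := by simp [signedSum]

lemma signedSum_add_one (f : ℤ → A) (n : ℤ) :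
    signedSum f (n + 1) = signedSum f n + f (n + 1) := by
  obtain ⟨g, hg⟩ := exists_antidifference f
  rw [signedSum_eq_sub hg, signedSum_eq_sub hg, ← hg]
  abel

lemma signedSum_congr {f g : ℤ → A} (h : ∀ k, f k = g k) (n : ℤ) :
    signedSum f n = signedSum g n := by rw [funext h]

lemma signedSum_add (f g : ℤ → A) (n : ℤ) :
    signedSum (fun k => f k + g k) n = signedSum f n + signedSum g n := by
  simp only [signedSum, Finset.sum_add_distrib]
  abel

lemma signedSum_sub (f g : ℤ → A) (n : ℤ) :
    signedSum (fun k => f k - g k) n = signedSum f n - signedSum g n := by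
  simp only [signedSum, Finset.sum_sub_distrib]
  abel

lemma map_signedSum {B F : Type*} [AddCommGroup B] [FunLike F A B] [AddMonoidHomClass F A B]
    (φ : F) (f : ℤ → A) (n : ℤ) : φ (signedSum f n) = signedSum (fun k => φ (f k)) n := by
  simp only [signedSum, map_sub, map_sum]

lemma signedSum_smul {R : Type*} [Ring R] [Module R A] (r : R) (f : ℤ → A) (n : ℤ) :
    signedSum (fun k => r • f k) n = r • signedSum f n := by
  simp only [signedSum, smul_sub, Finset.smul_sum]

/-- For `m ≥ 0` the middle term is `-(f 0 + f (-1) + ⋯ + f (-m))`, which cancels the other two. -/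
lemma signedSum_neg_add (f : ℤ → A) (m : ℤ) :
    f 0 + signedSum f (-m - 1) + signedSum (fun i => f (-i)) m = 0 := by
  obtain ⟨g, hg⟩ := exists_antidifference f
  rw [signedSum_eq_sub hg,
    signedSum_eq_sub (f := fun i => f (-i)) (g := fun n => - g (-n - 1)) (fun n => ?_)]
  · have h := hg (-1)
    rw [neg_add_cancel] at h
    rw [← h, neg_zero, zero_sub]
    abel
  · have h := hg (-(n + 1) - 1)
    rw [show -(n + 1) - 1 + 1 = -(n + 1) by ring] at h
    rw [← h, show -n - 1 = -(n + 1) by ring]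
    abel

/-- With `g` an antidifference of `f`, the inner sum is `g (i - m - 1) - g (-i)`, and the
substitution `i ↦ m + 1 - i` exchanges the two terms. -/
lemma signedSum_signedSum (f : ℤ → A) (m : ℤ) :
    signedSum (fun i => signedSum (fun l => f (l - i)) (2 * i - m - 1)) m = 0 := by
  obtain ⟨g, hg⟩ := exists_antidifference f
  obtain ⟨G, hG⟩ := exists_antidifference g
  have h1 : ∀ i, signedSum (fun l => f (l - i)) (2 * i - m - 1) = g (i - m - 1) - g (-i) := by
    intro i
    rw [signedSum_eq_sub (g := fun n => g (n - i)) (fun n => ?_)]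
    · congr 2 <;> ring
    · have h2 := hg (n - i)
      rw [show n + 1 - i = n - i + 1 by ring, h2]
  rw [signedSum_congr h1, signedSum_sub,
    signedSum_eq_sub (f := fun k => g (k - m - 1)) (g := fun n => G (n - m - 1)) (fun n => ?_),
    signedSum_eq_sub (f := fun k => g (-k)) (g := fun n => - G (-n - 1)) (fun n => ?_)]
  · rw [show m - m - 1 = -1 by ring, zero_sub, neg_zero, zero_sub]
    abel
  · have h2 := hG (-(n + 1) - 1)
    rw [show -(n + 1) - 1 + 1 = -(n + 1) by ring] at h2
    rw [← h2, show -n - 1 = -(n + 1) by ring]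
    abel
  · have h2 := hG (n - m - 1)
    rw [show n + 1 - m - 1 = n - m - 1 + 1 by ring, h2]

end SignedSum

/-! ### Monomials -/

section Monomials

variable {ι V N : Type*} [AddCommGroup V] [Module ℝ V] [AddCommGroup N] [Module ℝ N]
  {P : RootPairing ι ℝ V N} [Finite ι] [P.IsRootSystem] [P.IsIrreducible]

open scoped Classical in
/-- The monomial `x^v` for `v ∈ Λ/h`. -/
def mono (b : P.Base) (v : V) : ExtCharRing b :=
  if h : v ∈ scaledLattice b then AddMonoidAlgebra.single ⟨v, h⟩ 1 else 0

variable {b : P.Base}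

lemma mono_of_mem {v : V} (h : v ∈ scaledLattice b) :
    mono b v = AddMonoidAlgebra.single ⟨v, h⟩ 1 := dif_pos h

lemma mono_zero : mono b 0 = 1 := by
  rw [mono_of_mem (zero_mem _)]
  rfl

lemma mono_mul {v v' : V} (h : v ∈ scaledLattice b) (h' : v' ∈ scaledLattice b) :
    mono b v * mono b v' = mono b (v + v') := by
  rw [mono_of_mem h, mono_of_mem h', mono_of_mem (add_mem h h'),
    AddMonoidAlgebra.single_mul_single, one_mul]
  rfl

lemma mono_smul_mono_smul {M : Type*} [AddCommGroup M] [Module (ExtCharRing b) M] {v v' : V}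
    (h : v ∈ scaledLattice b) (h' : v' ∈ scaledLattice b) (x : M) :
    mono b v • mono b v' • x = mono b (v + v') • x := by
  rw [smul_smul, mono_mul h h']

lemma zsmul_root_mem [P.IsCrystallographic] (n : ℤ) (i : ι) :
    (n : ℝ) • P.root i ∈ scaledLattice b :=
  weightLattice_le_scaledLattice b (smul_mem_weightLattice_zsmul n (root_mem_weightLattice P i))

variable {M : Type*} [AddCommGroup M] [Module (ExtCharRing b) M]

open scoped Classical in
lemma opBPos_apply (O : Module.Basis P.weylGroup (ExtCharRing b) M) (i : ι) (w : P.weylGroup) :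
    opBPos O i (O w) =
      if len b (w * rootRefl P i) + 1 = len b w then O (w * rootRefl P i) else 0 := by
  rw [opBPos, Module.Basis.constr_basis]

variable [P.IsCrystallographic]

lemma opX_apply (O : Module.Basis P.weylGroup (ExtCharRing b) M) (lam : weightLattice P)
    (w : P.weylGroup) :
    opX O lam (O w) = mono b (w • ((coxeterNumber b : ℝ)⁻¹ • (lam : V))) • O w := by
  rw [opX, Module.Basis.constr_basis, mono_of_mem
    (smul_mem_scaledLattice b w (inv_smul_mem_scaledLattice b lam.2))]
  congr 2
  exact Subtype.ext (weyl_smul_smul P w _ _).symm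

end Monomials

/-! ### Alcove classes: the recursion and its behaviour across walls. -/

section AlcoveClasses

variable {ι V N : Type*} [AddCommGroup V] [Module ℝ V] [AddCommGroup N] [Module ℝ N]

lemma rootRefl_smul_rootRefl_smul_add (P : RootPairing ι ℝ V N) (p : V) (j : ι) (i l : ℤ) :
    rootRefl P j • (rootRefl P j • p + (i : ℝ) • P.root j) + (l : ℝ) • P.root j =
      p + ((l - i : ℤ) : ℝ) • P.root j := by
  rw [weyl_smul_add, weyl_smul_smul, ← mul_smul, rootRefl_mul_self, one_smul, ← root_smul,
    rootRefl_smul_self, root_negRoot]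
  push_cast
  module

variable {P : RootPairing ι ℝ V N} [Finite ι] [P.IsRootSystem] [P.IsIrreducible] {b : P.Base}

lemma Crosses.floor_eq {q : V} {β : ι} {k : ℤ} (h : Crosses b q β k) {γ : ι} (h1 : γ ≠ β)
    (h2 : γ ≠ negRoot P β) : ⌊P.coroot' γ (cross b q β)⌋ = ⌊P.coroot' γ q⌋ := by
  obtain ⟨n, ⟨h3, h4⟩, h5, h6⟩ := h.2 γ h1 h2
  rw [Int.floor_eq_iff.mpr ⟨h3.le, h4⟩, Int.floor_eq_iff.mpr ⟨h5.le, h6⟩]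

variable {M : Type*} [AddCommGroup M] [Module (ExtCharRing b) M]

variable (b) in
/-- How the classes change across a wall orthogonal to a positive root. -/
def CrossingRule (Φ : P.weylGroup → V → M) (w : P.weylGroup) (F : V → M) : Prop :=
  ∀ q ∈ centralPoints b, ∀ (β : ι) (k : ℤ), b.IsPos β → Crosses b q β k →
    F (cross b q β) = F q -
      if len b (w * rootRefl P β) + 1 = len b w then
        (mono b (((-k : ℤ) : ℝ) • P.root (w • β)) • Φ (w * rootRefl P β) q : M)
      else 0

/-- The operator which produces the alcove classes of `w = u s_j` from those of `u`. -/
def lift (T : b.support → Module.End (ExtCharRing b) M) (j : b.support) (u : P.weylGroup)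
    (Ψ : V → M) (p : V) : M :=
  T j (Ψ (rootRefl P (j : ι) • p)) +
    signedSum (fun i : ℤ => mono b ((i : ℝ) • P.root (u • (j : ι))) •
      Ψ (rootRefl P (j : ι) • p + (i : ℝ) • P.root j)) ⌊P.coroot' (j : ι) p⌋

open scoped Classical in
/-- The alcove classes, by recursion on an upper bound for the length. -/
def alcoveClassAux (O : Module.Basis P.weylGroup (ExtCharRing b) M)
    (T : b.support → Module.End (ExtCharRing b) M) : ℕ → P.weylGroup → V → M
  | 0, _ => fun _ => O 1
  | n + 1, w =>
    if h : ∃ j : b.support, ¬ b.IsPos (w • (j : ι)) then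
      lift T h.choose (w * rootRefl P (h.choose : ι))
        (alcoveClassAux O T n (w * rootRefl P (h.choose : ι)))
    else fun _ => O 1

/-- The class attached to `w ∈ W` and to the alcove with a given central point. The classes
attached to the translate of the fundamental alcove by `-λ` describe the operator `R^{[λ]}`. -/
def alcoveClass (O : Module.Basis P.weylGroup (ExtCharRing b) M)
    (T : b.support → Module.End (ExtCharRing b) M) (w : P.weylGroup) : V → M :=
  alcoveClassAux O T (len b w) w

variable {O : Module.Basis P.weylGroup (ExtCharRing b) M}
  {T : b.support → Module.End (ExtCharRing b) M}

lemma alcoveClass_one (p : V) : alcoveClass O T 1 p = O 1 := by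
  rw [alcoveClass, len_one]
  rfl

variable [P.IsCrystallographic]

lemma smul_add_mem_centralPoints (u : P.weylGroup) {p : V} (hp : p ∈ centralPoints b) (i : ℤ)
    (j : ι) : u • p + (i : ℝ) • P.root j ∈ centralPoints b :=
  add_mem_centralPoints (smul_mem_centralPoints _ hp)
    (smul_mem_weightLattice_zsmul i (root_mem_weightLattice P j))

variable [P.IsReduced]

lemma exists_alcoveClass_eq_lift {w : P.weylGroup} (hw : w ≠ 1) :
    ∃ j : b.support, ¬ b.IsPos (w • (j : ι)) ∧ alcoveClass O T w =
      lift T j (w * rootRefl P (j : ι)) (alcoveClass O T (w * rootRefl P (j : ι))) := by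
  classical
  have h := exists_descent b hw
  have h1 := len_mul_simple_of_not_isPos b h.choose_spec
  refine ⟨h.choose, h.choose_spec, ?_⟩
  rw [alcoveClass, ← h1, alcoveClassAux, dif_pos h]
  rfl

/-- The `-1` appears because `(p, α_j^∨)` is not an integer, so that `⌊-x⌋ = -⌊x⌋ - 1`. -/
lemma floor_coroot'_rootRefl_smul_add {p : V} (hp : p ∈ centralPoints b) (j : ι) (i : ℤ) :
    ⌊P.coroot' j (rootRefl P j • p + (i : ℝ) • P.root j)⌋ = 2 * i - ⌊P.coroot' j p⌋ - 1 := by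
  have h1 := Int.floor_le (P.coroot' j p)
  have h2 := Int.lt_floor_add_one (P.coroot' j p)
  have h3 := lt_of_le_of_ne h1 (coroot'_ne_intCast hp j _).symm
  rw [map_add, coroot'_smul, rootRefl_inv, rootRefl_smul_self, coroot'_negRoot,
    LinearMap.map_smul, coroot'_root_self, smul_eq_mul, Int.floor_eq_iff]
  push_cast
  exact ⟨by linarith, by linarith⟩

/-- Lifting twice along the same simple reflection gives zero. -/
lemma lift_lift (hT : ∀ j x, T j (T j x) = T j x) (j : b.support) (y : P.weylGroup)
    {Ψ Ψ' : V → M} (h : ∀ q ∈ centralPoints b, Ψ' q = lift T j y Ψ q) {p : V}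
    (hp : p ∈ centralPoints b) : lift T j (y * rootRefl P (j : ι)) Ψ' p = 0 := by
  set m := ⌊P.coroot' (j : ι) p⌋ with hm
  have hw : (y * rootRefl P (j : ι)) • (j : ι) = negRoot P (y • (j : ι)) := by
    rw [mul_smul, rootRefl_smul_self, smul_negRoot]
  let f : ℤ → M := fun l => mono b ((l : ℝ) • P.root (y • (j : ι))) •
    Ψ (p + (l : ℝ) • P.root j)
  have hmono : ∀ i l : ℤ, ∀ x : M, mono b ((i : ℝ) • P.root (negRoot P (y • (j : ι)))) •
      mono b ((l : ℝ) • P.root (y • (j : ι))) • x =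
      mono b (((l - i : ℤ) : ℝ) • P.root (y • (j : ι))) • x := by
    intro i l x
    rw [mono_smul_mono_smul (zsmul_root_mem _ _) (zsmul_root_mem _ _), root_negRoot]
    congr 2
    push_cast
    module
  -- The `i`-th term of the outer lift, with the inner lift expanded. The monomials combine so that
  -- only differences `l - i` remain.
  have hΨ : ∀ i : ℤ, mono b ((i : ℝ) • P.root (negRoot P (y • (j : ι)))) •
      Ψ' (rootRefl P (j : ι) • p + (i : ℝ) • P.root j) =
      T j (f (-i)) + signedSum (fun l => f (l - i)) (2 * i - m - 1) := by
    intro i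
    rw [h _ (smul_add_mem_centralPoints _ hp i j), lift, floor_coroot'_rootRefl_smul_add hp,
      ← hm, smul_add, ← signedSum_smul, ← map_smul]
    congr 2
    · have h1 := rootRefl_smul_rootRefl_smul_add P p j i 0
      have h2 := hmono i 0 (Ψ (p + ((0 - i : ℤ) : ℝ) • P.root j))
      simp only [Int.cast_zero, zero_smul, add_zero, mono_zero, one_smul] at h1 h2
      rw [h1, h2, zero_sub]
    · funext l
      rw [rootRefl_smul_rootRefl_smul_add, hmono]
  have h0 := hΨ 0
  simp only [Int.cast_zero, zero_smul, add_zero, mono_zero, one_smul, neg_zero, sub_zero,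
    mul_zero, zero_sub] at h0
  -- The double sum vanishes by `signedSum_signedSum`. Since `T_j² = T_j`, the rest is `T_j` applied
  -- to the combination that is zero by `signedSum_neg_add`.
  rw [lift, hw, ← hm, signedSum_congr hΨ, signedSum_add, signedSum_signedSum, add_zero, h0,
    map_add, hT, map_signedSum (T j)]
  have h3 := signedSum_neg_add (fun i => T j (f i)) m
  exact h3

/-- For `β ≠ α_j` the root `s_j(β)` is positive, so the rule for `w s_j` applies to each term of the
lift, while the range of summation is unaffected. The length condition obtained concerns `w s_j`,
not yet `w`; `crossingRule_lift` reconciles the two. -/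
lemma lift_cross_of_ne {Φ : P.weylGroup → V → M} {w : P.weylGroup} {j : b.support}
    (hΦ : CrossingRule b Φ (w * rootRefl P (j : ι)) (Φ (w * rootRefl P (j : ι))))
    {q : V} (hq : q ∈ centralPoints b) {β : ι} {k : ℤ} (hβ : b.IsPos β) (hβj : β ≠ j)
    (hc : Crosses b q β k) :
    lift T j (w * rootRefl P (j : ι)) (Φ (w * rootRefl P (j : ι))) (cross b q β) =
      lift T j (w * rootRefl P (j : ι)) (Φ (w * rootRefl P (j : ι))) q -
      if len b (w * rootRefl P β * rootRefl P (j : ι)) + 1 = len b (w * rootRefl P (j : ι)) then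
        mono b (((-k : ℤ) : ℝ) • P.root (w • β)) •
          lift T j (w * rootRefl P β * rootRefl P (j : ι))
            (Φ (w * rootRefl P β * rootRefl P (j : ι))) q
      else 0 := by
  set s := rootRefl P (j : ι) with hs
  have hss : s * s = 1 := rootRefl_mul_self P j
  have hneg : (j : ι) ≠ negRoot P β := by
    intro h
    have h1 := b.isPos_of_mem_support j.2
    rw [h, isPos_negRoot] at h1
    exact h1 hβ
  have hfloor := hc.floor_eq hβj.symm hneg
  have hwβ : (w * s) • s • β = w • β := by
    rw [smul_smul, mul_assoc, hss, mul_one]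
  have hwj : (w * s) • (j : ι) = negRoot P (w • (j : ι)) := by
    rw [mul_smul, hs, rootRefl_smul_self, smul_negRoot]
  have hyj : (w * rootRefl P β * s) • (j : ι) = negRoot P ((w * rootRefl P β) • (j : ι)) := by
    rw [mul_smul, hs, rootRefl_smul_self, smul_negRoot]
  have hrefl : w * s * rootRefl P (s • β) = w * rootRefl P β * s := by
    have h : rootRefl P (s • β) = s * rootRefl P β * s := by
      rw [mul_rootRefl P s, mul_assoc, hss, mul_one]
    rw [h]
    simp only [mul_assoc]
    rw [← mul_assoc s s, hss, one_mul]
  obtain ⟨n, hn⟩ : ∃ n : ℤ, (n : ℝ) = P.coroot' β (P.root j) := ⟨_, (coroot'_root P β j).symm⟩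
  have hterm : ∀ i : ℤ, mono b ((i : ℝ) • P.root ((w * s) • (j : ι))) •
      Φ (w * s) (s • cross b q β + (i : ℝ) • P.root j) =
      mono b ((i : ℝ) • P.root ((w * s) • (j : ι))) • Φ (w * s) (s • q + (i : ℝ) • P.root j) -
      if len b (w * rootRefl P β * s) + 1 = len b (w * s) then
        mono b (((-k : ℤ) : ℝ) • P.root (w • β)) •
          mono b ((i : ℝ) • P.root ((w * rootRefl P β * s) • (j : ι))) •
          Φ (w * rootRefl P β * s) (s • q + (i : ℝ) • P.root j) else 0 := by
    intro i
    -- Translation by `i α_j` moves the level of the wall by `-i (α_j, β^∨)`; the change of monomial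
    -- from `w(α_j)` to `w s_β(α_j)` absorbs this shift.
    have h1 : Crosses b (s • q + (i : ℝ) • P.root j) (s • β) (k - i * n) := by
      refine hc.smul_add s (smul_mem_weightLattice_zsmul i (root_mem_weightLattice P j)) ?_
      rw [LinearMap.map_smul]
      have h2 : P.coroot' (s • β) (P.root j) = - n := by
        have h3 := coroot'_smul_smul P s β (P.root (negRoot P (j : ι)))
        rw [root_negRoot, smul_neg, ← root_smul, hs, rootRefl_smul_self, root_negRoot, neg_neg,
          map_neg, ← hn] at h3
        exact h3
      rw [h2, smul_eq_mul]
      push_cast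
      ring
    have h2 := hΦ _ (smul_add_mem_centralPoints s hq i j) _ _
      (isPos_rootRefl_smul b j hβ hβj) h1
    rw [cross_smul_add, hrefl, hwβ] at h2
    rw [h2, smul_sub]
    congr 1
    split_ifs
    · rw [mono_smul_mono_smul (zsmul_root_mem _ _) (zsmul_root_mem _ _),
        mono_smul_mono_smul (zsmul_root_mem _ _) (zsmul_root_mem _ _), hwj, hyj, root_negRoot,
        root_negRoot]
      congr 2
      rw [root_smul P (w * rootRefl P β), mul_smul, rootRefl_smul, ← hn, weyl_smul_sub,
        weyl_smul_smul, ← root_smul, ← root_smul]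
      push_cast
      module
    · rw [smul_zero]
  have h0 := hterm 0
  simp only [Int.cast_zero, zero_smul, add_zero, mono_zero, one_smul] at h0
  rw [lift, lift, hfloor, signedSum_congr hterm, signedSum_sub, h0, map_sub]
  split_ifs
  · rw [map_smul, lift, smul_add, ← signedSum_smul]
    abel
  · have h1 : signedSum (fun _ : ℤ => (0 : M)) ⌊P.coroot' (j : ι) q⌋ = 0 := by
      simp [signedSum]
    rw [h1, map_zero]
    abel

lemma CrossingRule.eq_of_isPos {Φ : P.weylGroup → V → M} {u : P.weylGroup} {F : V → M}
    (hF : CrossingRule b Φ u F) {q : V} (hq : q ∈ centralPoints b) {β : ι} {k : ℤ}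
    (hβ : b.IsPos β) (hu : b.IsPos (u • β)) (hc : Crosses b q β k) :
    F (cross b q β) = F q := by
  have h := len_lt_mul_rootRefl b hβ hu
  rw [hF q hq β k hβ hc, if_neg (by lia), sub_zero]

/-- As `u(α_j)` is positive, `F` does not notice walls orthogonal to `α_j`. The one effect of the
crossing is that the floor drops from `k` to `k - 1`, so the last term of the sum is lost. -/
lemma lift_cross_self {Φ : P.weylGroup → V → M} {u : P.weylGroup} {j : b.support} {F : V → M}
    (hF : CrossingRule b Φ u F) (hu : b.IsPos (u • (j : ι)))
    {q : V} (hq : q ∈ centralPoints b) {k : ℤ} (hc : Crosses b q j k) :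
    lift T j u F (cross b q j) =
      lift T j u F q - mono b ((k : ℝ) • P.root (u • (j : ι))) • F q := by
  have hj := b.isPos_of_mem_support j.2
  have hpos := inv_coxeterNumber_pos b
  have hlt := inv_coxeterNumber_lt_one b
  have h1 : ⌊P.coroot' (j : ι) q⌋ = k := by
    rw [hc.1, Int.floor_eq_iff]
    exact ⟨by linarith, by linarith⟩
  have h2 : ⌊P.coroot' (j : ι) (cross b q j)⌋ = k - 1 := by
    rw [coroot'_cross hc.1, Int.floor_eq_iff]
    push_cast
    exact ⟨by linarith, by linarith⟩
  have h3 : ∀ i : ℤ, F (rootRefl P (j : ι) • cross b q j + (i : ℝ) • P.root j) =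
      F (rootRefl P (j : ι) • q + (i : ℝ) • P.root j) := by
    intro i
    have h4 := hc.symm.smul_add (rootRefl P (j : ι)) (k' := -k + 2 * i)
      (smul_mem_weightLattice_zsmul i (root_mem_weightLattice P j)) (by
        rw [smul_negRoot, rootRefl_smul_self, negRoot_negRoot, LinearMap.map_smul,
          coroot'_root_self, smul_eq_mul]
        push_cast
        ring)
    have h5 := cross_smul_add (b := b) (rootRefl P (j : ι)) (cross b q j)
      ((i : ℝ) • P.root j) (negRoot P j)
    rw [cross_cross_negRoot, smul_negRoot, rootRefl_smul_self, negRoot_negRoot] at h5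
    rw [smul_negRoot, rootRefl_smul_self, negRoot_negRoot] at h4
    rw [← h5, hF.eq_of_isPos
      (smul_add_mem_centralPoints _ (cross_mem_centralPoints hq hc) i j) hj hu h4]
  have h6 := h3 0
  simp only [Int.cast_zero, zero_smul, add_zero] at h6
  -- The lost term, of index `k`, is evaluated at the mirror image of `q` in the crossed wall, where
  -- `F` takes the same value as at `q`.
  have h7 : F (rootRefl P (j : ι) • q + (k : ℝ) • P.root j) = F q := by
    rw [← cross_eq hc.1, hF.eq_of_isPos hq hj hu hc]
  have h8 := signedSum_add_one (fun i : ℤ => mono b ((i : ℝ) • P.root (u • (j : ι))) •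
      F (rootRefl P (j : ι) • q + (i : ℝ) • P.root j)) (k - 1)
  rw [sub_add_cancel, h7] at h8
  simp only [lift, h1, h2, h3, h6, h8]
  abel

end AlcoveClasses

/-! ### Functions on central points are determined by their jumps. -/

section Connectedness

variable {ι V N A : Type*} [AddCommGroup V] [Module ℝ V] [AddCommGroup N] [Module ℝ N]
  {P : RootPairing ι ℝ V N} [Finite ι] [P.IsRootSystem] [P.IsIrreducible] [P.IsCrystallographic]
  [P.IsReduced] {b : P.Base} [AddCommGroup A]

/-- Two functions which change in the same way across each wall differ by a constant. -/
lemma eq_of_cross {F G : V → A} (h0 : F (center b) = G (center b))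
    (h : ∀ q ∈ centralPoints b, ∀ (β : ι) (k : ℤ), b.IsPos β → Crosses b q β k →
      F (cross b q β) - F q = G (cross b q β) - G q) {q : V} (hq : q ∈ centralPoints b) :
    F q = G q := by
  obtain ⟨l, hl⟩ := exists_isPath hq
  induction l generalizing q with
  | nil =>
    rw [IsPath] at hl
    rw [hl, h0]
  | cons β l ih =>
    obtain ⟨⟨k, hk⟩, h1⟩ := hl
    have h2 := cross_mem_centralPoints hq hk
    have h3 := ih h2 h1
    by_cases hβ : b.IsPos β
    · have h4 := h q hq β k hβ hk
      rw [h3] at h4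
      exact sub_right_injective h4
    · rw [← isPos_negRoot] at hβ
      have h4 := h _ h2 _ _ hβ hk.symm
      rw [cross_cross_negRoot, h3] at h4
      exact sub_left_injective h4

end Connectedness

/-! ### The crossing rule for all alcove classes. -/

section Demazure

variable {ι V N : Type*} [AddCommGroup V] [Module ℝ V] [AddCommGroup N] [Module ℝ N]
  {P : RootPairing ι ℝ V N} [Finite ι] [P.IsRootSystem] [P.IsIrreducible] {b : P.Base}
  {M : Type*} [AddCommGroup M] [Module (ExtCharRing b) M]

/-- The operators `T_j` act on the basis `O` as the elementary Demazure operators do on the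
Schubert classes. -/
def ActsAsDemazure (O : Module.Basis P.weylGroup (ExtCharRing b) M)
    (T : b.support → Module.End (ExtCharRing b) M) : Prop :=
  ∀ (j : b.support) (w : P.weylGroup),
    (b.IsPos (w • (j : ι)) → T j (O w) = O (w * rootRefl P (j : ι))) ∧
      (¬ b.IsPos (w • (j : ι)) → T j (O w) = O w)

variable {O : Module.Basis P.weylGroup (ExtCharRing b) M}
  {T : b.support → Module.End (ExtCharRing b) M}

lemma ActsAsDemazure.idempotent [P.IsCrystallographic] (h : ActsAsDemazure O T) (j : b.support)
    (x : M) : T j (T j x) = T j x := by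
  have h1 : T j ∘ₗ T j = T j := by
    apply O.ext
    intro w
    rw [LinearMap.comp_apply]
    by_cases hw : b.IsPos (w • (j : ι))
    · rw [(h j w).1 hw]
      refine (h j _).2 ?_
      rw [mul_smul, rootRefl_smul_self, smul_negRoot, isPos_negRoot]
      exact fun h1 => h1 hw
    · rw [(h j w).2 hw, (h j w).2 hw]
  exact LinearMap.congr_fun h1 x

variable [P.IsCrystallographic] [P.IsReduced]

/-- The properties of the alcove classes of `w` which are proved by induction on the length. -/
def HasCrossingRule (O : Module.Basis P.weylGroup (ExtCharRing b) M)
    (T : b.support → Module.End (ExtCharRing b) M) (w : P.weylGroup) : Prop :=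
  CrossingRule b (alcoveClass O T) w (alcoveClass O T w) ∧
    alcoveClass O T w (center b) = O w ∧
    ∀ j : b.support, ¬ b.IsPos (w • (j : ι)) → ∀ p ∈ centralPoints b, alcoveClass O T w p =
      lift T j (w * rootRefl P (j : ι)) (alcoveClass O T (w * rootRefl P (j : ι))) p

/-- For `β = α_j` the lost term of the sum is the required correction. For `β ≠ α_j` the correction
is itself a lift, to be compared with the class of `y = w s_β`. -/
lemma crossingRule_lift (h : ActsAsDemazure O T) {w : P.weylGroup}
    (ih : ∀ y, len b y < len b w → HasCrossingRule O T y) {j : b.support}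
    (hj : ¬ b.IsPos (w • (j : ι))) :
    CrossingRule b (alcoveClass O T) w
      (lift T j (w * rootRefl P (j : ι)) (alcoveClass O T (w * rootRefl P (j : ι)))) := by
  have hlen := len_mul_simple_of_not_isPos b hj
  obtain ⟨hcr, -, -⟩ := ih (w * rootRefl P (j : ι)) (by lia)
  intro q hq β k hβ hc
  by_cases hβj : β = j
  · subst hβj
    have hu : b.IsPos ((w * rootRefl P (j : ι)) • (j : ι)) := by
      rwa [mul_smul, rootRefl_smul_self, smul_negRoot, isPos_negRoot]
    rw [lift_cross_self hcr hu hq hc, if_pos hlen, mul_smul, rootRefl_smul_self, smul_negRoot,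
      root_negRoot]
    congr 3
    push_cast
    module
  · rw [lift_cross_of_ne (Φ := alcoveClass O T) hcr hq hβ hβj hc]
    congr 1
    set y := w * rootRefl P β with hy
    have hpos := isPos_rootRefl_smul b j hβ hβj
    have hwβ : (w * rootRefl P (j : ι)) • rootRefl P (j : ι) • β = w • β := by
      rw [smul_smul, mul_rootRefl_mul_rootRefl]
    have hys : w * rootRefl P (j : ι) * rootRefl P (rootRefl P (j : ι) • β) =
        y * rootRefl P (j : ι) := by
      rw [mul_rootRefl P (w * rootRefl P (j : ι)), hwβ, hy, mul_rootRefl P w β, mul_assoc]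
    -- If `y(α_j)` is positive, `y` is not one shorter than `w`, so no correction is allowed; the
    -- one that may arise is a double lift along `j` and vanishes. If `y(α_j)` is negative, `s_j`
    -- shortens both `w` and `y`, the two length conditions agree, and the lift is the class of `y`.
    by_cases hyj : b.IsPos (y • (j : ι))
    · have h1 := len_mul_simple_of_isPos b hyj
      have h2 : ¬ len b y + 1 = len b w := by
        intro h2
        have hw : ¬ b.IsPos (w • β) := by
          intro h3
          have h4 := len_lt_mul_rootRefl b hβ h3
          rw [← hy] at h4
          lia
        rw [← hwβ] at hw
        have h3 := len_mul_rootRefl_lt b hpos hw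
        rw [hys] at h3
        lia
      rw [if_neg h2]
      split_ifs with h3
      · rw [lift_lift h.idempotent j y (Ψ := alcoveClass O T y) (fun p hp => ?_) hq, smul_zero]
        have h4 := (ih (y * rootRefl P (j : ι)) (by lia)).2.2 j (by
          rw [mul_smul, rootRefl_smul_self, smul_negRoot, isPos_negRoot]
          exact fun h4 => h4 hyj) p hp
        rwa [mul_rootRefl_mul_rootRefl] at h4
      · rfl
    · have h1 := len_mul_simple_of_not_isPos b hyj
      have h2 : (len b (y * rootRefl P (j : ι)) + 1 = len b (w * rootRefl P (j : ι))) ↔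
          (len b y + 1 = len b w) := by lia
      rw [if_congr h2 rfl rfl]
      split_ifs with h3
      · rw [(ih y (by lia)).2.2 j hyj q hq]
      · rfl

lemma floor_coroot'_center (j : b.support) : ⌊P.coroot' (j : ι) (center b)⌋ = 0 := by
  rw [Int.floor_eq_iff, Int.cast_zero, zero_add]
  exact ⟨(coroot'_center_pos b (b.isPos_of_mem_support j.2)).le, coroot'_center_lt_one b _⟩

/-- At `ρ/h` the floor is zero, so the sum is empty; `F_u(s_j(ρ/h)) = F_u(ρ/h)` since `u(α_j)` is
positive. -/
lemma lift_center (h : ActsAsDemazure O T) {u : P.weylGroup} (hu : HasCrossingRule O T u)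
    {j : b.support} (hj : b.IsPos (u • (j : ι))) :
    lift T j u (alcoveClass O T u) (center b) = O (u * rootRefl P (j : ι)) := by
  have hc := crosses_center (b := b) (some j)
  have h1 := hu.1.eq_of_isPos center_mem_centralPoints (b.isPos_of_mem_support j.2) hj hc
  have h2 := cross_eq hc.1
  simp only [alpha, genLevel, Int.cast_zero, zero_smul, add_zero] at h1 h2
  rw [lift, floor_coroot'_center, signedSum_zero, add_zero, ← h2, h1, hu.2.1, (h j u).1 hj]

lemma hasCrossingRule (h : ActsAsDemazure O T) (w : P.weylGroup) : HasCrossingRule O T w := by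
  induction hn : len b w using Nat.strong_induction_on generalizing w with
  | _ n ih =>
  have ih' : ∀ y, len b y < len b w → HasCrossingRule O T y :=
    fun y hy => ih (len b y) (by lia) y rfl
  by_cases hw : w = 1
  · subst hw
    refine ⟨fun q _ β k _ _ => ?_, alcoveClass_one _, fun j hj => ?_⟩
    · rw [alcoveClass_one, alcoveClass_one, len_one, if_neg (by lia), sub_zero]
    · rw [one_smul] at hj
      exact absurd (b.isPos_of_mem_support j.2) hj
  · have key : ∀ j : b.support, ¬ b.IsPos (w • (j : ι)) →
        lift T j (w * rootRefl P (j : ι)) (alcoveClass O T (w * rootRefl P (j : ι))) (center b) =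
          O w := by
      intro j hj
      have h1 := lift_center h (ih' _ (by
        have := len_mul_simple_of_not_isPos b hj
        lia)) (u := w * rootRefl P (j : ι)) (j := j) (by
          rwa [mul_smul, rootRefl_smul_self, smul_negRoot, isPos_negRoot])
      rwa [mul_rootRefl_mul_rootRefl] at h1
    obtain ⟨j, hj, hjw⟩ := exists_alcoveClass_eq_lift (O := O) (T := T) hw
    have h1 := crossingRule_lift h ih' hj
    rw [HasCrossingRule]
    refine ⟨by rwa [hjw], by rw [hjw, key j hj], fun i hi p hp => ?_⟩
    rw [hjw]
    -- The lifts along two descents `i` and `j` agree at `ρ/h` and satisfy the same crossing rule,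
    -- so they are equal.
    refine eq_of_cross (by rw [key j hj, key i hi]) (fun q hq β k hβ hc => ?_) hp
    rw [h1 q hq β k hβ hc, crossingRule_lift h ih' hi q hq β k hβ hc]
    abel

end Demazure

section Sign

variable {ι V N : Type*} [AddCommGroup V] [Module ℝ V] [AddCommGroup N] [Module ℝ N]

open scoped Classical in
/-- The sign of a root. -/
def rootSign {P : RootPairing ι ℝ V N} (b : P.Base) (β : ι) : ℤ := if b.IsPos β then 1 else -1

lemma rootSign_of_isPos {P : RootPairing ι ℝ V N} {b : P.Base} {β : ι} (h : b.IsPos β) : rootSign b β = 1 := if_pos h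

lemma rootSign_of_not_isPos {P : RootPairing ι ℝ V N} {b : P.Base} {β : ι} (h : ¬ b.IsPos β) : rootSign b β = -1 := if_neg h

end Sign

/-! ### Path operators expressed through alcove classes. -/

section PathFormula

variable {ι V N : Type*} [AddCommGroup V] [Module ℝ V] [AddCommGroup N] [Module ℝ N]
  {P : RootPairing ι ℝ V N} [Finite ι] [P.IsRootSystem] [P.IsIrreducible] {b : P.Base}
  {M : Type*} [AddCommGroup M] [Module (ExtCharRing b) M]
  {O : Module.Basis P.weylGroup (ExtCharRing b) M}
  {T : b.support → Module.End (ExtCharRing b) M}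

variable [P.IsCrystallographic]

lemma opR_apply (β : ι) (w : P.weylGroup) :
    opR O β (O w) = mono b ((coxeterNumber b : ℝ)⁻¹ • P.root (w • β)) • O w +
      rootSign b β • (if len b (w * rootRefl P β) + 1 = len b w then
        mono b (-((coxeterNumber b : ℝ)⁻¹ * coheight b β) • P.root (w • β)) •
          O (w * rootRefl P β)
      else 0) := by
  have h1 : (w * rootRefl P β) •
      ((coxeterNumber b : ℝ)⁻¹ • ((coheight b β • rootWeight P β : weightLattice P) : V)) =
      -((coxeterNumber b : ℝ)⁻¹ * coheight b β) • P.root (w • β) := by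
    have h2 : ((coheight b β • rootWeight P β : weightLattice P) : V) =
        (coheight b β : ℝ) • P.root β := by
      rw [Int.cast_smul_eq_zsmul]
      rfl
    rw [h2, smul_smul, weyl_smul_smul, ← root_smul, mul_smul w _ β, rootRefl_smul_self,
      smul_negRoot, root_negRoot]
    module
  have h3 : w • ((coxeterNumber b : ℝ)⁻¹ • (rootWeight P β : V)) =
      (coxeterNumber b : ℝ)⁻¹ • P.root (w • β) := by
    rw [weyl_smul_smul, root_smul]
    rfl
  rw [opR, LinearMap.add_apply, opX_apply, h3, Module.End.mul_apply]
  congr 1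
  by_cases hβ : b.IsPos β
  · rw [opB, if_pos hβ, rootSign_of_isPos hβ, one_smul, opBPos_apply]
    split_ifs
    · rw [opX_apply, h1]
    · rw [map_zero]
  · rw [opB, if_neg hβ, rootSign_of_not_isPos hβ, LinearMap.neg_apply, map_neg, opBPos_apply,
      rootRefl_negRoot, neg_smul, one_smul]
    congr 1
    split_ifs
    · rw [opX_apply, h1]
    · rw [map_zero]

variable [P.IsReduced]

/-- The element `w s_β` is shorter than `w = (w s_β) s_β`, so the rule for `w s_β` has no correction
across this wall. The correction in the rule for `w` may thus be evaluated on either side. -/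
lemma alcoveClass_cross_of_cover (h : ActsAsDemazure O T) {w : P.weylGroup} {q : V}
    (hq : q ∈ centralPoints b) {β : ι} {k : ℤ} (hc : Crosses b q β k)
    (hw : len b (w * rootRefl P β) + 1 = len b w) :
    alcoveClass O T (w * rootRefl P β) (cross b q β) = alcoveClass O T (w * rootRefl P β) q := by
  have key : ∀ γ : ι, b.IsPos γ → rootRefl P γ = rootRefl P β →
      b.IsPos ((w * rootRefl P β) • γ) := by
    intro γ hγ hγβ
    rw [← hγβ, mul_smul, rootRefl_smul_self, smul_negRoot, isPos_negRoot]
    intro h1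
    have h2 := len_lt_mul_rootRefl b hγ h1
    rw [hγβ] at h2
    lia
  have hcr := (hasCrossingRule h (w * rootRefl P β)).1
  by_cases hβ : b.IsPos β
  · exact hcr.eq_of_isPos hq hβ (key β hβ rfl) hc
  · rw [← isPos_negRoot] at hβ
    have h1 := hcr.eq_of_isPos (cross_mem_centralPoints hq hc) hβ
      (key _ hβ (rootRefl_negRoot P β)) hc.symm
    rw [cross_cross_negRoot] at h1
    exact h1.symm

/-- The crossing rule for walls orthogonal to an arbitrary root. -/
lemma alcoveClass_cross (h : ActsAsDemazure O T) (w : P.weylGroup) {q : V}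
    (hq : q ∈ centralPoints b) {β : ι} {k : ℤ} (hc : Crosses b q β k) :
    alcoveClass O T w (cross b q β) = alcoveClass O T w q -
      rootSign b β • (if len b (w * rootRefl P β) + 1 = len b w then
        mono b (((-k : ℤ) : ℝ) • P.root (w • β)) • alcoveClass O T (w * rootRefl P β) q
      else 0) := by
  have hcr := (hasCrossingRule h w).1
  by_cases hβ : b.IsPos β
  · rw [hcr q hq β k hβ hc, rootSign_of_isPos hβ, one_smul]
  · have hβ' := hβ
    rw [← isPos_negRoot] at hβ'
    have h1 := hcr _ (cross_mem_centralPoints hq hc) _ _ hβ' hc.symm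
    rw [cross_cross_negRoot, rootRefl_negRoot, smul_negRoot, root_negRoot] at h1
    have h2 : ((-(-k) : ℤ) : ℝ) • -P.root (w • β) = ((-k : ℤ) : ℝ) • P.root (w • β) := by
      push_cast
      module
    rw [rootSign_of_not_isPos hβ, h1, h2]
    split_ifs with hw
    · rw [alcoveClass_cross_of_cover h hq hc hw]
      module
    · module

/-- Composing the operators `R_β` along a path from the alcove of `q` to the fundamental one. -/
lemma chainOperator_apply (h : ActsAsDemazure O T) {l : List ι} {q : V} (hq : q ∈ centralPoints b)
    (hl : IsPath b q l) (w : P.weylGroup) :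
    chainOperator O l (O w) = mono b (w • (q - center b)) • alcoveClass O T w q := by
  induction l generalizing q w with
  | nil =>
    rw [IsPath] at hl
    rw [hl, sub_self, smul_zero, mono_zero, one_smul, (hasCrossingRule h w).2.1]
    rfl
  | cons β l ih =>
    obtain ⟨⟨k, hc⟩, hl⟩ := hl
    have hq' := cross_mem_centralPoints hq hc
    have hmem : ∀ (u : P.weylGroup) {x : V}, x ∈ centralPoints b →
        u • (x - center b) ∈ scaledLattice b := fun u x hx =>
      smul_mem_scaledLattice b u (sub_mem (centralPoints_subset hx) (center_mem b))
    have h1 : chainOperator O (β :: l) = chainOperator O l * opR O β := by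
      simp [chainOperator]
    have hmem1 : (coxeterNumber b : ℝ)⁻¹ • P.root (w • β) ∈ scaledLattice b :=
      inv_smul_mem_scaledLattice b (root_mem_weightLattice P _)
    have hmem2 : -((coxeterNumber b : ℝ)⁻¹ * coheight b β) • P.root (w • β) ∈
        scaledLattice b := by
      have h2 := inv_smul_mem_scaledLattice b
        (smul_mem_weightLattice_zsmul (-coheight b β) (root_mem_weightLattice P (w • β)))
      rw [smul_smul] at h2
      push_cast at h2
      rwa [mul_neg] at h2
    rw [h1, Module.End.mul_apply, opR_apply, map_add, map_smul, map_zsmul, ih hq' hl,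
      mono_smul_mono_smul hmem1 (hmem w hq'), alcoveClass_cross h w hq hc, smul_sub]
    have h3 : (coxeterNumber b : ℝ)⁻¹ • P.root (w • β) + w • (cross b q β - center b) =
        w • (q - center b) := by
      rw [cross, root_smul, ← weyl_smul_smul, ← weyl_smul_add]
      congr 1
      abel
    rw [h3, smul_comm (mono b (w • (q - center b))) (rootSign b β)]
    have h4 : chainOperator O l (if len b (w * rootRefl P β) + 1 = len b w then
        mono b (-((coxeterNumber b : ℝ)⁻¹ * coheight b β) • P.root (w • β)) •
          O (w * rootRefl P β) else 0) = mono b (w • (q - center b)) •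
        (if len b (w * rootRefl P β) + 1 = len b w then
          mono b (((-k : ℤ) : ℝ) • P.root (w • β)) • alcoveClass O T (w * rootRefl P β) q
        else 0) := by
      split_ifs with hw
      · rw [map_smul, ih hq' hl, mono_smul_mono_smul hmem2 (hmem _ hq'),
          mono_smul_mono_smul (hmem _ hq) (zsmul_root_mem _ _),
          alcoveClass_cross_of_cover h hq hc hw]
        congr 2
        -- The term `(ρ, β^∨)/h` cancels against the twist `X^{(ρ, β^∨) β}` in `R_β`, leaving the
        -- integral exponent `-k` of the crossing rule.
        have h5 : rootRefl P β • (cross b q β - center b) = q - center b +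
            (-(k : ℝ) + (coxeterNumber b : ℝ)⁻¹ * coheight b β) • P.root β := by
          rw [rootRefl_smul, map_sub, coroot'_cross hc.1, coroot'_center, cross]
          module
        rw [mul_smul, h5, weyl_smul_add, weyl_smul_smul, ← root_smul]
        generalize w • (q - center b) = x
        push_cast
        module
      · rw [map_zero, smul_zero]
    rw [h4]
    abel

lemma pathOperator_apply (h : ActsAsDemazure O T) (lam : weightLattice P) (w : P.weylGroup) :
    pathOperator O lam (O w) = mono b (w • (lam : V)) • alcoveClass O T w (center b + lam) := by
  have h1 := Classical.epsilon_spec (exists_isLambdaChain (b := b) lam)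
  rw [pathOperator, chainOperator_apply h
    (add_mem_centralPoints center_mem_centralPoints lam.2) h1.isPath, add_sub_cancel_left]

lemma chainOperator_eq_pathOperator (h : ActsAsDemazure O T) {lam : weightLattice P} {β : List ι}
    (hβ : IsLambdaChain b lam β) : chainOperator O β = pathOperator O lam := by
  apply O.ext
  intro w
  rw [pathOperator_apply h, chainOperator_apply h
    (add_mem_centralPoints center_mem_centralPoints lam.2) hβ.isPath, add_sub_cancel_left]

end PathFormula

/-- Substituting `k = m - i` converts the range `0 < i ≤ m` of the recursion into the range `0 ≤ k <
m` of the commutation relation. -/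
lemma signedSum_sub_left {A : Type*} [AddCommGroup A] (F : ℤ → A) (m : ℤ) :
    signedSum (fun i => F (m - i)) m =
      ∑ k ∈ Finset.Ico 0 m, F k - ∑ k ∈ Finset.Ico m 0, F k := by
  rw [signedSum]
  congr 1 <;>
  exact Finset.sum_nbij' (fun k => m - (k + 1)) (fun k => m - (k + 1))
    (fun k hk => by rw [Finset.mem_Ico] at *; lia) (fun k hk => by rw [Finset.mem_Ico] at *; lia)
    (fun k _ => by ring) (fun k _ => by ring) (fun k _ => rfl)

/-! ### The commutation relation. -/

section Commutation

variable {ι V N : Type*} [AddCommGroup V] [Module ℝ V] [AddCommGroup N] [Module ℝ N]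
  {P : RootPairing ι ℝ V N} [P.IsCrystallographic]

lemma weightPairing_add_zsmul (lam : weightLattice P) (n : ℤ) (i : ι) :
    weightPairing P (lam + n • rootWeight P i) i = weightPairing P lam i + 2 * n := by
  have h1 : ((n • rootWeight P i : weightLattice P) : V) = (n : ℝ) • P.root i := by
    rw [Int.cast_smul_eq_zsmul]
    rfl
  have h2 := coe_weightPairing P (lam + n • rootWeight P i) i
  rw [AddSubgroup.coe_add, h1, map_add, ← coe_weightPairing, LinearMap.map_smul,
    coroot'_root_self, smul_eq_mul, mul_comm] at h2
  exact_mod_cast h2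

variable [Finite ι] [P.IsRootSystem] [P.IsIrreducible] [P.IsReduced] {b : P.Base}
  {M : Type*} [AddCommGroup M] [Module (ExtCharRing b) M]
  {O : Module.Basis P.weylGroup (ExtCharRing b) M}
  {T : b.support → Module.End (ExtCharRing b) M}

lemma floor_coroot'_center_add (j : b.support) (lam : weightLattice P) :
    ⌊P.coroot' (j : ι) (center b + (lam : V))⌋ = weightPairing P lam j := by
  rw [map_add, ← coe_weightPairing, Int.floor_add_intCast, floor_coroot'_center, zero_add]

lemma alcoveClass_rootRefl_smul_center_add (h : ActsAsDemazure O T) {u : P.weylGroup}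
    {j : b.support} (hu : b.IsPos (u • (j : ι))) {μ : V} (hμ : μ ∈ weightLattice P) :
    alcoveClass O T u (rootRefl P (j : ι) • center b + μ) = alcoveClass O T u (center b + μ) := by
  have hc := crosses_center (b := b) (some j)
  have h2 := cross_eq hc.1
  simp only [alpha, genLevel, Int.cast_zero, zero_smul, add_zero] at h2
  obtain ⟨n, hn⟩ := hμ (j : ι)
  have h3 := hc.add hμ (k' := genLevel b (some j) + n) (by
    rw [alpha, ← hn]
    push_cast
    ring)
  rw [← h2, ← cross_add]
  exact (hasCrossingRule h u).1.eq_of_isPos (add_mem_centralPoints center_mem_centralPoints hμ)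
    (b.isPos_of_mem_support j.2) hu h3

/-- This is the recursion for the class of `u s_j` at `ρ/h + λ`. The arguments `s_j(ρ/h) + ν` may be
replaced by `ρ/h + ν`, since only an `α_j`-wall lies between them. -/
lemma pathOperator_apply_of_isPos (h : ActsAsDemazure O T) (lam : weightLattice P)
    {u : P.weylGroup} {j : b.support} (hu : b.IsPos (u • (j : ι))) :
    pathOperator O lam (T j (O u)) =
      T j (pathOperator O (weylAct P (rootRefl P (j : ι)) lam) (O u)) +
      signedSum (fun i => pathOperator O
        (weylAct P (rootRefl P (j : ι)) lam + i • rootWeight P j) (O u))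
        (weightPairing P lam j) := by
  have hterm : ∀ i : ℤ, mono b ((u * rootRefl P (j : ι)) • (lam : V)) •
      mono b ((i : ℝ) • P.root (u • (j : ι))) •
      alcoveClass O T u (rootRefl P (j : ι) • (center b + lam) + (i : ℝ) • P.root j) =
      pathOperator O (weylAct P (rootRefl P (j : ι)) lam + i • rootWeight P j) (O u) := by
    intro i
    have h1 : ((weylAct P (rootRefl P (j : ι)) lam + i • rootWeight P j : weightLattice P) : V) =
        rootRefl P (j : ι) • (lam : V) + (i : ℝ) • P.root j := by
      rw [Int.cast_smul_eq_zsmul]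
      rfl
    rw [pathOperator_apply h, mono_smul_mono_smul (smul_mem_scaledLattice b _
      (weightLattice_le_scaledLattice b lam.2)) (zsmul_root_mem _ _), weyl_smul_add P _ (center b),
      add_assoc, ← h1, alcoveClass_rootRefl_smul_center_add h hu (Subtype.property _), h1,
      weyl_smul_add P u, weyl_smul_smul, root_smul, mul_smul]
  have h0 := hterm 0
  simp only [Int.cast_zero, zero_smul, add_zero, mono_zero, one_smul] at h0
  rw [(h j u).1 hu, pathOperator_apply h, (hasCrossingRule h _).2.2 j (by
    rw [mul_smul, rootRefl_smul_self, smul_negRoot, isPos_negRoot]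
    exact fun h1 => h1 hu) _ (add_mem_centralPoints center_mem_centralPoints lam.2),
    mul_rootRefl_mul_rootRefl, lift, floor_coroot'_center_add, smul_add, ← map_smul, h0,
    ← signedSum_smul, signedSum_congr hterm]

/-- The commutation relation between the path operators and the Demazure operators. -/
lemma pathOperator_mul (h : ActsAsDemazure O T) (lam : weightLattice P) (j : b.support) :
    pathOperator O lam * T j =
      T j * pathOperator O (weylAct P (rootRefl P (j : ι)) lam) +
        ∑ k ∈ Finset.Ico 0 (weightPairing P lam j), pathOperator O (lam - k • rootWeight P j) -
        ∑ k ∈ Finset.Ico (weightPairing P lam j) 0,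
          pathOperator O (lam - k • rootWeight P j) := by
  have hasc : ∀ (μ : weightLattice P) (z : P.weylGroup), b.IsPos (z • (j : ι)) →
      pathOperator O μ (T j (O z)) =
        T j (pathOperator O (μ - weightPairing P μ j • rootWeight P j) (O z)) +
        signedSum (fun i => pathOperator O (μ - (weightPairing P μ j - i) • rootWeight P j) (O z))
          (weightPairing P μ j) := by
    intro μ z hz
    rw [pathOperator_apply_of_isPos h μ hz, weylAct_refl]
    congr 1
    refine signedSum_congr (fun i => ?_) _
    congr 2
    module
  rw [add_sub_assoc, ← signedSum_sub_left]
  apply O.ext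
  intro y
  rw [LinearMap.add_apply, Module.End.mul_apply, Module.End.mul_apply, weylAct_refl]
  have hsum : ∀ (G : ℤ → Module.End (ExtCharRing b) M) (x : M) (n : ℤ),
      (signedSum G n) x = signedSum (fun i => G i x) n := fun G x n =>
    map_signedSum (LinearMap.applyₗ x) G n
  rw [hsum]
  by_cases hy : b.IsPos (y • (j : ι))
  · rw [hasc lam y hy]
  -- At a descent `[O_y] = T_j [O_z]`, and every path operator meeting `T_j [O_z]` is expanded by
  -- the case already settled.
  · obtain ⟨z, hz, hyz⟩ : ∃ z, b.IsPos (z • (j : ι)) ∧ O y = T j (O z) := by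
      have hz : b.IsPos ((y * rootRefl P (j : ι)) • (j : ι)) := by
        rwa [mul_smul, rootRefl_smul_self, smul_negRoot, isPos_negRoot]
      exact ⟨_, hz, by rw [(h j _).1 hz, mul_rootRefl_mul_rootRefl]⟩
    set m := weightPairing P lam j
    let f : ℤ → M := fun l => pathOperator O (lam + l • rootWeight P j) (O z)
    have hf : ∀ i : ℤ, pathOperator O (lam - (m - i) • rootWeight P j) (T j (O z)) =
        T j (f (-i)) + signedSum (fun l => f (l - i)) (2 * i - m - 1) + f (i - m) := by
      intro i
      have h1 : lam - (m - i) • rootWeight P j = lam + (i - m) • rootWeight P j := by module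
      have h2 := signedSum_add_one (fun l => f (l - i)) (2 * i - m - 1)
      have h3 : weightPairing P (lam + (i - m) • rootWeight P j) j = 2 * i - m := by
        rw [weightPairing_add_zsmul]
        ring
      rw [sub_add_cancel, show 2 * i - m - i = i - m by ring] at h2
      rw [h1, hasc _ z hz, h3, add_assoc, ← h2]
      congr 1
      · congr 3
        module
      · refine signedSum_congr (fun l => ?_) _
        congr 2
        module
    have hf0 := hf 0
    rw [sub_zero] at hf0
    have hlhs : pathOperator O lam (T j (O z)) =
        T j (f (-m)) + signedSum (fun i => f (i - m)) m := by
      rw [hasc lam z hz]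
      congr 1
      · congr 3
        module
      · refine signedSum_congr (fun i => ?_) _
        congr 2
        module
    rw [hyz, h.idempotent, hlhs, hf0, signedSum_congr hf, signedSum_add, signedSum_add,
      signedSum_signedSum, add_zero, map_add, map_add, h.idempotent]
    -- After the double sum has vanished and `T_j²` has been reduced to `T_j`, the surplus terms are
    -- `T_j` applied to this zero combination.
    have h6 := congrArg (T j) (signedSum_neg_add f m)
    rw [map_add, map_add, map_zero, map_signedSum (T j) (fun i => f (-i))] at h6
    simp only [neg_zero, sub_zero, mul_zero, zero_sub] at h6 ⊢
    rw [eq_neg_of_add_eq_zero_right h6]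
    abel

end Commutation

/-! ### Idempotence of the Demazure operators. -/

section DemazureIdempotent

variable {ι V N : Type*} [AddCommGroup V] [Module ℝ V] [AddCommGroup N] [Module ℝ N]
  (P : RootPairing ι ℝ V N) [P.IsCrystallographic]

lemma weylAct_rootRefl_neg_rootWeight (i : ι) :
    weylAct P (rootRefl P i) (-rootWeight P i) = rootWeight P i := by
  apply Subtype.ext
  change rootRefl P i • (-P.root i) = P.root i
  rw [smul_neg, ← root_smul, rootRefl_smul_self, root_negRoot, neg_neg]

lemma weylBig_rootRefl_rootRefl (i : ι) (f : BigRing P) :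
    weylBig P (rootRefl P i) (weylBig P (rootRefl P i) f) = f := by
  have h1 : ∀ x, weylActHom P (rootRefl P i) (weylActHom P (rootRefl P i) x) = x := fun x =>
    Subtype.ext (by
      change rootRefl P i • rootRefl P i • (x : V) = x
      rw [← mul_smul, rootRefl_mul_self, one_smul])
  have h : (weylBig P (rootRefl P i)).comp (weylBig P (rootRefl P i)) = RingHom.id _ := by
    ext x <;> simp [weylBig, h1]
  exact congrArg (fun φ => φ f) h

/-- Applying `s_α` to the defining equation of the quotient and multiplying by `-e^{-α}` gives the
same equation back, so the quotient is `s_α`-invariant. On invariant elements the operator is the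
identity, hence it is idempotent. -/
lemma weylBig_demazure (i : ι) (f : BigRing P) :
    weylBig P (rootRefl P i) (demazure P i f) = demazure P i f := by
  apply demazure_unique
  have h1 := congrArg (fun x => expo P (-rootWeight P i) * weylBig P (rootRefl P i) x)
    (demazure_spec P i f)
  have h2 : expo P (-rootWeight P i) * expo P (rootWeight P i) = 1 := by
    rw [expo_mul, neg_add_cancel]
    rfl
  simp only [map_mul, map_sub, map_one, weylBig_expo, weylAct_rootRefl_neg_rootWeight,
    weylBig_rootRefl_rootRefl] at h1
  linear_combination -h1 + (f - weylBig P (rootRefl P i) (demazure P i f)) * h2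

lemma demazure_demazure (i : ι) (f : BigRing P) :
    demazure P i (demazure P i f) = demazure P i f := by
  symm
  apply demazure_unique
  rw [weylBig_demazure]
  ring

lemma demazureKT_demazureKT (i : ι) (x : KT P) :
    demazureKT P i (demazureKT P i x) = demazureKT P i x := by
  obtain ⟨f, rfl⟩ := Ideal.Quotient.mk_surjective x
  rw [demazureKT_mk, demazureKT_mk, demazure_demazure]

end DemazureIdempotent

/-! ### Both models act on their bases as Demazure operators. -/

section SchubertBases

variable {ι V N : Type*} [AddCommGroup V] [Module ℝ V] [AddCommGroup N] [Module ℝ N]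
  {P : RootPairing ι ℝ V N} [Finite ι] [P.IsCrystallographic] [P.IsReduced] {b : P.Base}

lemma IsSchubertBasis.demazureKT_apply {O : Module.Basis P.weylGroup (CharRing P) (KT P)}
    (hO : IsSchubertBasis b O) (j : b.support) {w : P.weylGroup} (h : b.IsPos (w • (j : ι))) :
    demazureKT P (j : ι) (O w) = O (w * rootRefl P (j : ι)) := by
  obtain ⟨l, hl, rfl⟩ := exists_reduced b w
  have h1 : wordProd b (l ++ [j]) = wordProd b l * rootRefl P (j : ι) := by
    simp [wordProd]
  have h2 := hO (l ++ [j]) (by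
    rw [h1, len_mul_simple_of_isPos b h, List.length_append, hl, List.length_singleton])
  rw [← h1, h2, hO l hl]
  simp

variable [P.IsRootSystem] [P.IsIrreducible]

lemma actsAsDemazure_schubertT : ActsAsDemazure (schubertClass b) (schubertT b) := by
  intro j w
  rw [schubertT, Module.Basis.constr_basis]
  refine ⟨fun h => if_pos ((len_mul_simple_eq_iff b w j).mpr h),
    fun h => if_neg (mt (len_mul_simple_eq_iff b w j).mp h)⟩

lemma IsSchubertBasis.actsAsDemazure {O : Module.Basis P.weylGroup (CharRing P) (KT P)}
    (hO : IsSchubertBasis b O) : ActsAsDemazure (extBasis b O) (demazureExt b) := by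
  intro j w
  have h1 : ∀ u, extBasis b O u = 1 ⊗ₜ[CharRing P] O u := fun u => by
    rw [extBasis, Module.Basis.baseChange_apply]
  simp only [h1, demazureExt, LinearMap.baseChange_tmul]
  refine ⟨fun h => by rw [hO.demazureKT_apply j h], fun h => ?_⟩
  -- At a descent the basis vector lies in the image of the operator, and idempotence shows that it
  -- is fixed.
  have h2 := hO.demazureKT_apply j (w := w * rootRefl P (j : ι)) (by
    rwa [mul_smul, rootRefl_smul_self, smul_negRoot, isPos_negRoot])
  rw [mul_rootRefl_mul_rootRefl] at h2
  rw [← h2, demazureKT_demazureKT]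

end SchubertBases

end PathOperators

end

theorem proposition12p5 {ι V N : Type*} [Finite ι] [AddCommGroup V] [Module ℝ V]
    [AddCommGroup N] [Module ℝ N] (P : RootPairing ι ℝ V N) [P.IsRootSystem]
    [P.IsCrystallographic] [P.IsReduced] [P.IsIrreducible] (b : P.Base) :
    -- every weight has a chain
    (∀ lam : weightLattice P, ∃ β : List ι, IsLambdaChain b lam β) ∧
    -- the path operators on the free module on the Schubert classes do not depend on the chains,
    -- and satisfy the commutation relations with the operators `T_i`
    ((∀ (lam : weightLattice P) (β : List ι), IsLambdaChain b lam β →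
        chainOperator (schubertClass b) β =
          pathOperator (schubertClass b) lam) ∧
      ∀ (lam : weightLattice P) (i : b.support),
        pathOperator (schubertClass b) lam *
            schubertT b i =
          schubertT b i *
              pathOperator (schubertClass b)
                (weylAct P (rootRefl P i) lam) +
            ∑ k ∈ Finset.Ico 0 (weightPairing P lam i),
              pathOperator (schubertClass b)
                (lam - k • rootWeight P i) -
            ∑ k ∈ Finset.Ico (weightPairing P lam i) 0,
              pathOperator (schubertClass b)
                (lam - k • rootWeight P i)) ∧
    -- the same for the operators induced by the Demazure operators on the quotient presentation
    -- of the Grothendieck ring, the basis of Schubert classes being generated by them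
    ∀ O : Module.Basis P.weylGroup (CharRing P) (KT P),
      IsSchubertBasis b O →
      (∀ (lam : weightLattice P) (β : List ι), IsLambdaChain b lam β →
        chainOperator (extBasis b O) β =
          pathOperator (extBasis b O) lam) ∧
      ∀ (lam : weightLattice P) (i : b.support),
        pathOperator (extBasis b O) lam *
            demazureExt b i =
          demazureExt b i *
              pathOperator (extBasis b O)
                (weylAct P (rootRefl P i) lam) +
            ∑ k ∈ Finset.Ico 0 (weightPairing P lam i),
              pathOperator (extBasis b O)
                (lam - k • rootWeight P i) -
            ∑ k ∈ Finset.Ico (weightPairing P lam i) 0,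
              pathOperator (extBasis b O)
                (lam - k • rootWeight P i) := by
  have hS := actsAsDemazure_schubertT (b := b)
  exact ⟨exists_isLambdaChain, ⟨fun _ _ => chainOperator_eq_pathOperator hS, pathOperator_mul hS⟩,
    fun _ hO => ⟨fun _ _ => chainOperator_eq_pathOperator hO.actsAsDemazure,
      pathOperator_mul hO.actsAsDemazure⟩⟩
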